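/- Let $\alpha=[0;a_1,a_2,\dots]\in(0,\tfrac12)$ be irrational (so $a_1\ge 2$). A Sturmian word of slope $\alpha$ is an infinite word over $\{0,1\}$ that codes the orbit of a point of the circle $\mathbb R/\mathbb Z$ under rotation by $\alpha$ with respect to the two intervals $I_0,I_1$ with endpoints $0$ and $1-\alpha$, where either $I_0=[0,1-\alpha)$, $I_1=[1-\alpha,1)$ or $I_0=(0,1-\alpha]$, $I_1=(1-\alpha,1]$; $\mathcal L(\alpha)$ is the set of finite factors of such words. Write $\widetilde w$ for the reversal of a word $w$ and $|w|$ for its length. Let $s_0=0$, $s_1=0^{a_1-1}1$, $s_k=s_{k-1}^{a_k}s_{k-2}$ for $k\ge 2$, and $s_{k,\ell}=s_{k-1}^{\ell}s_{k-2}$ for $k\ge2$, $0<\ell\le a_k$. With $\mathfrak a=a_1-1$ and $\mathfrak b=a_2-1$, the minimal square roots of slope $\alpha$ are the six words $$0,\quad 010^{\mathfrak a-1},\quad 010^{\mathfrak a},\quad 10^{\mathfrak a},\quad 10^{\mathfrak a+1}(10^{\mathfrak a})^{\mathfrak b},\quad 10^{\mathfrak a+1}(10^{\mathfrak a})^{\mathfrak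 b+1}.$$ A nonempty word $w$ with $w^2\in\mathcal L(\alpha)$ is called a solution if $w=Y_1Y_2\cdots Y_n$ for minimal square roots $Y_i$ such that $Y_1^2Y_2^2\cdots Y_n^2=(Y_1Y_2\cdots Y_n)^2$. The maximal solution of an infinite word $t$ is the longest solution $w$ such that $w^2$ is a prefix of $t$, if a longest one exists. Let $s=X_1^2X_2^2X_3^2\cdots$ be a Sturmian word of slope $\alpha$ of type A, factorized as a product of squares of maximal solutions; that is, for every $i\ge1$ the word $X_i$ is the maximal solution of the word obtained from $s$ by deleting its prefix $X_1^2\cdots X_{i-1}^2$. (1) If $|X_1|>|X_2|$, then $X_1=\widetilde{s}_{k,\ell}$ and the primitive root of $X_2$ is $\widetilde{s}_{k-1}$ for some $k\ge2$ and some $\ell$ with $0<\ell\le a_k-1$, and moreover $|X_3|>|X_1|$. (2) $\liminf_{i\to\infty}|X_i|=\infty$. -/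

import Mathlib

/-- Finite words over the alphabet `{0, 1}`. -/
abbrev BinWord := List (Fin 2)

/-- Infinite words over the alphabet `{0, 1}`. -/
abbrev InfWord := ℕ → Fin 2

namespace BinWord

/-- The power `w ^ n`, the concatenation of `n` copies of `w`. -/
def pow (w : BinWord) (n : ℕ) : BinWord := (List.replicate n w).flatten

/-- `w` is primitive: it is of the form `z ^ n` only for `n = 1`. (The empty word is not primitive.) -/
def IsPrimitive (w : BinWord) : Prop := ∀ (z : BinWord) (n : ℕ), w = z.pow n → n = 1

/-- `u` is the primitive root of `w`. -/
def IsRootOf (u w : BinWord) : Prop := u.IsPrimitive ∧ ∃ n : ℕ, 1 ≤ n ∧ w = u.pow n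

/-- The word `w` occurs in the infinite word `s` at position `n`, that is, `w` is a prefix of the
`n`-th shift of `s`. -/
def OccursAt (w : BinWord) (s : InfWord) (n : ℕ) : Prop :=
  ∀ (i : ℕ) (hi : i < w.length), w[i] = s (n + i)

end BinWord

namespace Sturmian

/-- The partial quotient `a_k` of the continued fraction `α = [a_0; a_1, a_2, …]`
(as a natural number; for irrational `α` this is the `k`-th partial quotient for all `k ≥ 1`). -/
noncomputable def partialQuotient (α : ℝ) (k : ℕ) : ℕ :=
  ((GenContFract.IntFractPair.stream α k).map fun p => p.b.toNat).getD 0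

/-- The standard words `s_k`, `k ≥ 0`, of slope `α`:
`s_0 = 0`, `s_1 = 0 ^ (a_1 - 1) 1`, and `s_k = s_{k-1} ^ a_k s_{k-2}` for `k ≥ 2`. -/
noncomputable def standardWord (α : ℝ) : ℕ → BinWord
  | 0 => [0]
  | 1 => List.replicate (partialQuotient α 1 - 1) 0 ++ [1]
  | k + 2 => (standardWord α (k + 1)).pow (partialQuotient α (k + 2)) ++ standardWord α k

/-- The word `s_{k,ℓ} = s_{k-1} ^ ℓ s_{k-2}` (used for `k ≥ 2`); it is the semistandard word if
`1 ≤ ℓ < a_k`, and `s_{k, a_k} = s_k`. -/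
noncomputable def semistandardWord (α : ℝ) (k ℓ : ℕ) : BinWord :=
  (standardWord α (k - 1)).pow ℓ ++ standardWord α (k - 2)

/-- `s` is a Sturmian word of slope `α` (for irrational `α` in `(0, 1)`): it is the coding of the
orbit of some point `x` of the circle `ℝ / ℤ` under the rotation by `α`, with respect to the
intervals `I_0`, `I_1` with endpoints `0` and `1 - α`, for one of the two conventions
`I_1 = [1 - α, 1)` and `I_1 = (1 - α, 1]`; in the latter `1` is the same point as `0`. -/
def IsSturmian (α : ℝ) (s : InfWord) : Prop :=
  ∃ x : ℝ,
    (∀ n : ℕ, s n = 1 ↔ 1 - α ≤ Int.fract (x + n * α)) ∨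
    (∀ n : ℕ, s n = 1 ↔ (1 - α < Int.fract (x + n * α) ∨ Int.fract (x + n * α) = 0))

/-- The language `L(α)`: the set of factors of the Sturmian words of slope `α`. -/
def language (α : ℝ) : Set BinWord :=
  {w | ∃ s : InfWord, IsSturmian α s ∧ ∃ n : ℕ, w.OccursAt s n}

/-- The six minimal square roots for the parameters `a ≥ 1` and `b ≥ 0`. -/
def minimalSquareRoots (a b : ℕ) : Set BinWord :=
  let z : ℕ → BinWord := fun n => List.replicate n 0
  { [0],
    [0, 1] ++ z (a - 1),
    [0, 1] ++ z a,
    [1] ++ z a,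
    [1] ++ z (a + 1) ++ BinWord.pow ([1] ++ z a) b,
    [1] ++ z (a + 1) ++ BinWord.pow ([1] ++ z a) (b + 1) }

/-- The nonempty word `w` is a solution, in the language `L(α)`, to the word equation
`Y_1² Y_2² ⋯ Y_n² = (Y_1 Y_2 ⋯ Y_n)²`: it is a product `w = Y_1 ⋯ Y_n` of minimal square roots of
slope `α` (the parameters are `a_1 - 1` and `a_2 - 1`) satisfying the equation, and `w² ∈ L(α)`. -/
def IsSolution (α : ℝ) (w : BinWord) : Prop :=
  w ≠ [] ∧
  (∃ Y : List BinWord,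
    (∀ y ∈ Y, y ∈ minimalSquareRoots (partialQuotient α 1 - 1) (partialQuotient α 2 - 1)) ∧
    Y.flatten = w ∧
    (Y.map fun y => y ++ y).flatten = w ++ w) ∧
  w ++ w ∈ language α

/-- `w` is the maximal solution at position `n` of `s`: it is the longest solution whose square is a
prefix of the `n`-th shift of `s`. -/
def IsMaximalSolutionAt (α : ℝ) (s : InfWord) (n : ℕ) (w : BinWord) : Prop :=
  (IsSolution α w ∧ (w ++ w).OccursAt s n) ∧
  ∀ v : BinWord, IsSolution α v → (v ++ v).OccursAt s n → v.length ≤ w.length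

/-- `s = X_1² X_2² X_3² ⋯` is the factorization of the type A Sturmian word `s` of slope `α` as a
product of squares of maximal solutions: `X_{i+1}` (which is `X i`) is the maximal solution at
position `|X_1² ⋯ X_i²|` of `s`. -/
def IsTypeAFactorization (α : ℝ) (s : InfWord) (X : ℕ → BinWord) : Prop :=
  IsSturmian α s ∧
  ∀ i : ℕ, IsMaximalSolutionAt α s (∑ j ∈ Finset.range i, 2 * (X j).length) (X i)

end Sturmian

/-! Put the origin of the circle at `1 - α`. Then the letter of a point in the fundamental domain
`(α - 1, α)` is decided by its sign. Reading the reversed standard word `S k` moves a point by `t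
k`, the distance from `q_k α` to the nearest integer, in a direction that alternates with `k`; the
sign `e K k` normalizes the side, so that `z > 0` moves to `z - t k`.

The square root operation is halving: if a product of squares of minimal roots is read from `y`,
then the product of the roots themselves is read from `y / 2` (`codes_half_of_squares`). So a
solution at `y` is a common prefix of the codings of `y` and `y / 2`, and it ends before any letter
at which these two orbits lie on opposite sides of `0`. Conversely, a word `w` whose square is read
from `y` and which is read from `y / 2` is a solution as soon as some product of minimal roots of
the same length has its squares read from `y` and is itself read from `y / 2` (`Parses.solutionAt`).
Existence of solutions thus becomes a statement about lengths, proved by an induction of Rauzy type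
(`ParsesStage`).

The two bounds give all maximal solutions (`MaxSolutionAt.step`). They are powers of `S k`, after
which the point is within `t k` of `0`, or semistandard words `W k l` with `0 < l < a (k + 2)`,
after which the point has crossed `0`. A point within `t k` of `0` has a maximal solution at least
as long as `S (k + 1)`. Hence a drop in length can only follow a semistandard step that ends beyond
`t (k + 1)`; the next factor is then a power of `S (k + 1)`, and the one after it is longer than
both. Moreover any two consecutive steps bring a point within `t k` of `0` to within `t (k + 1)`, so
the lengths tend to infinity.

Endpoints are avoided by moving the starting point by `ε` or `-ε` in the hyperreals, one sign for
each interval convention. The orbit is then never real, and all comparisons with real endpoints are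
strict. -/

set_option linter.unusedSectionVars false

/-! ### Powers of words, primitivity and commutation -/

namespace BinWord

theorem pow_zero' (w : BinWord) : w.pow 0 = [] := rfl

theorem pow_succ' (w : BinWord) (n : ℕ) : w.pow (n + 1) = w ++ w.pow n := by
  simp [pow, List.replicate_succ]

theorem pow_succ_right (w : BinWord) (n : ℕ) : w.pow (n + 1) = w.pow n ++ w := by
  simp [pow, List.replicate_succ']

theorem pow_one' (w : BinWord) : w.pow 1 = w := by simp [pow]

theorem pow_add' (w : BinWord) (m n : ℕ) : w.pow (m + n) = w.pow m ++ w.pow n := by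
  simp only [pow, List.replicate_add, List.flatten_append]

theorem length_pow (w : BinWord) (n : ℕ) : (w.pow n).length = n * w.length := by
  simp [pow]

theorem count_pow (w : BinWord) (c : Fin 2) (n : ℕ) : (w.pow n).count c = n * w.count c := by
  induction n with
  | zero => simp [pow_zero']
  | succ n ih => rw [pow_succ', List.count_append, ih]; ring

theorem reverse_pow (w : BinWord) (n : ℕ) : (w.pow n).reverse = BinWord.pow w.reverse n := by
  induction n with
  | zero => rfl
  | succ n ih => rw [pow_succ', List.reverse_append, ih, pow_succ_right]

theorem isPrimitive_of_coprime {w : BinWord} (h : Nat.Coprime w.length (w.count 1)) :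
    w.IsPrimitive := by
  rintro z n rfl
  rw [length_pow, count_pow] at h
  exact Nat.Coprime.eq_one_of_dvd (Nat.Coprime.coprime_mul_right h |>.coprime_mul_right_right)
    dvd_rfl

/-- Two commuting words are powers of a common word. -/
theorem exists_pow_of_append_comm (x y : BinWord) (h : x ++ y = y ++ x) :
    ∃ (z : BinWord) (m n : ℕ), x = z.pow m ∧ y = z.pow n := by
  induction hk : x.length + y.length using Nat.strong_induction_on generalizing x y with
  | _ k ih =>
    rcases eq_or_ne x [] with rfl | hx
    · exact ⟨y, 0, 1, rfl, (pow_one' y).symm⟩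
    rcases eq_or_ne y [] with rfl | hy
    · exact ⟨x, 1, 0, (pow_one' x).symm, rfl⟩
    have hx' := List.length_pos_of_ne_nil hx
    have hy' := List.length_pos_of_ne_nil hy
    rcases le_total x.length y.length with hl | hl
    · obtain ⟨y', rfl⟩ : x <+: y :=
        List.prefix_of_prefix_length_le (l₃ := x ++ y) (List.prefix_append _ _)
          (h ▸ List.prefix_append _ _) hl
      rw [List.append_assoc] at h
      obtain ⟨z, m, n, hm, hn⟩ := ih _ (by simp only [List.length_append] at hk; omega) x y'
        (List.append_cancel_left h) rfl
      exact ⟨z, m, m + n, hm, by rw [pow_add', ← hm, ← hn]⟩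
    · obtain ⟨x', rfl⟩ : y <+: x :=
        List.prefix_of_prefix_length_le (l₃ := x ++ y) (h ▸ List.prefix_append _ _)
          (List.prefix_append _ _) hl
      rw [List.append_assoc] at h
      obtain ⟨z, m, n, hm, hn⟩ := ih _ (by simp only [List.length_append] at hk; omega) x' y
        (List.append_cancel_left h) rfl
      exact ⟨z, n + m, n, by rw [pow_add', ← hm, ← hn], hn⟩

theorem IsPrimitive.eq_nil_or_eq_nil_of_append_comm {x y : BinWord}
    (hp : IsPrimitive (x ++ y)) (h : x ++ y = y ++ x) : x = [] ∨ y = [] := by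
  obtain ⟨z, m, n, rfl, rfl⟩ := exists_pow_of_append_comm x y h
  have := hp z (m + n) (pow_add' z m n).symm
  rcases Nat.add_eq_one_iff.1 this with ⟨rfl, _⟩ | ⟨_, rfl⟩
  · exact Or.inl rfl
  · exact Or.inr rfl

end BinWord

/-! ### Reversed standard and semistandard words -/

namespace Sturmian

/-- The reversed standard words with partial quotients `a`. -/
def revStandard (a : ℕ → ℕ) : ℕ → BinWord
  | 0 => [0]
  | 1 => [1] ++ List.replicate (a 1 - 1) 0
  | k + 2 => revStandard a k ++ BinWord.pow (revStandard a (k + 1)) (a (k + 2))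

/-- The reversal of the word `s_{k+2,l} = s_{k+1} ^ l s_k`. -/
def revSemistandard (a : ℕ → ℕ) (k l : ℕ) : BinWord :=
  revStandard a k ++ BinWord.pow (revStandard a (k + 1)) l

variable (a : ℕ → ℕ)

theorem revSemistandard_zero (k : ℕ) : revSemistandard a k 0 = revStandard a k := by
  simp [revSemistandard, BinWord.pow_zero']

theorem revSemistandard_succ (k l : ℕ) :
    revSemistandard a k (l + 1) = revSemistandard a k l ++ revStandard a (k + 1) := by
  simp [revSemistandard, BinWord.pow_succ_right]

theorem revSemistandard_self (k : ℕ) :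
    revSemistandard a k (a (k + 2)) = revStandard a (k + 2) := by
  simp [revSemistandard, revStandard]

theorem length_revSemistandard (k l : ℕ) : (revSemistandard a k l).length =
    (revStandard a k).length + l * (revStandard a (k + 1)).length := by
  simp [revSemistandard, BinWord.length_pow]

theorem length_revStandard_add_two (k : ℕ) : (revStandard a (k + 2)).length =
    (revStandard a k).length + a (k + 2) * (revStandard a (k + 1)).length := by
  rw [← revSemistandard_self, length_revSemistandard]

theorem length_revStandard_one (h : 2 ≤ a 1) : (revStandard a 1).length = a 1 := by
  simp [revStandard]; omega

theorem length_revStandard_lt (h1 : 2 ≤ a 1) (ha : ∀ k, 1 ≤ a (k + 2)) (k : ℕ) :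
    (revStandard a k).length < (revStandard a (k + 1)).length := by
  have key : ∀ k, 0 < (revStandard a k).length ∧
      (revStandard a k).length < (revStandard a (k + 1)).length := by
    intro k
    induction k with
    | zero => rw [length_revStandard_one a h1]; simp [revStandard]; omega
    | succ k ih =>
      refine ⟨by omega, ?_⟩
      rw [length_revStandard_add_two]
      nlinarith [ha k]
  exact (key k).2

theorem length_revStandard_mono (h1 : 2 ≤ a 1) (ha : ∀ k, 1 ≤ a (k + 2)) :
    StrictMono fun k => (revStandard a k).length :=
  strictMono_nat_of_lt_succ (length_revStandard_lt a h1 ha)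

theorem lt_length_revStandard (h1 : 2 ≤ a 1) (ha : ∀ k, 1 ≤ a (k + 2)) (k : ℕ) :
    k < (revStandard a k).length := by
  induction k with
  | zero => simp [revStandard]
  | succ k ih => exact lt_of_le_of_lt ih (length_revStandard_lt a h1 ha k)

/-- Consecutive pairs (length, number of ones) have determinant `±1`, because the recursion is a
unimodular step; this is a Bézout relation. Its purpose is primitivity. -/
theorem coprime_length_count_revStandard (k : ℕ) :
    Nat.Coprime (revStandard a k).length ((revStandard a k).count 1) := by
  have key : ∀ k, ((revStandard a (k + 1)).length * (revStandard a k).count 1 -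
      (revStandard a k).length * (revStandard a (k + 1)).count 1 : ℤ) = (-1) ^ (k + 1) := by
    intro k
    induction k with
    | zero =>
      simp [revStandard, List.count_replicate]
    | succ k ih =>
      have hc : (revStandard a (k + 2)).count 1 = (revStandard a k).count 1 +
          a (k + 2) * (revStandard a (k + 1)).count 1 := by
        simp [revStandard, BinWord.count_pow]
      rw [show k + 1 + 1 = k + 2 from rfl, length_revStandard_add_two, hc, pow_succ, ← ih]
      push_cast
      ring
  rw [← Nat.isCoprime_iff_coprime]
  have hk := key k
  have hs : ((-1 : ℤ) ^ (k + 1)) * (-1) ^ (k + 1) = 1 := by rw [← mul_pow]; simp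
  refine ⟨-((-1) ^ (k + 1) * (revStandard a (k + 1)).count 1),
    (-1) ^ (k + 1) * (revStandard a (k + 1)).length, ?_⟩
  linear_combination hs + (-1) ^ (k + 1) * hk

theorem isPrimitive_revStandard (k : ℕ) : (revStandard a k).IsPrimitive :=
  BinWord.isPrimitive_of_coprime (coprime_length_count_revStandard a k)

theorem reverse_standardWord (α : ℝ) (k : ℕ) :
    (standardWord α k).reverse = revStandard (partialQuotient α) k := by
  induction k using Nat.twoStepInduction with
  | zero => rfl
  | one => simp [standardWord, revStandard]
  | more k ih1 ih2 =>
    simp [standardWord, revStandard, BinWord.reverse_pow, ih1, ih2]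

theorem reverse_semistandardWord (α : ℝ) (k l : ℕ) :
    (semistandardWord α (k + 2) l).reverse = revSemistandard (partialQuotient α) k l := by
  simp [semistandardWord, revSemistandard, BinWord.reverse_pow, reverse_standardWord]

end Sturmian

/-! ### Rotations and the intervals coded by the words -/

namespace Sturmian

/-- The rotation of the circle `K / ℤ` by the angle `t 0`, for an ordered field `K`. Here `a k` are
the partial quotients of the angle, `t k` is the distance of `q_k * t 0` to the nearest integer, and
`F` is a subfield containing the angle. -/
structure RotationData (K : Type*) [Field K] [LinearOrder K] where
  F : Subfield K
  a : ℕ → ℕ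
  t : ℕ → K
  t_mem : ∀ k, t k ∈ F
  t_pos : ∀ k, 0 < t k
  t_lt : ∀ k, t (k + 1) < t k
  two_le_a_one : 2 ≤ a 1
  t_one : t 1 = 1 - a 1 * t 0
  t_rec : ∀ k, t (k + 2) = t k - a (k + 2) * t (k + 1)

namespace RotationData

variable {K : Type*} [Field K] [LinearOrder K] [IsStrictOrderedRing K] (D : RotationData K)

theorem one_le_a (k : ℕ) : 1 ≤ D.a (k + 2) := by
  by_contra! h
  have h0 : D.a (k + 2) = 0 := by omega
  have := D.t_rec k
  rw [h0] at this
  have h1 := D.t_lt k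
  have h2 := D.t_lt (k + 1)
  push_cast at this
  rw [show k + 1 + 1 = k + 2 from rfl] at h2
  linarith

theorem t_anti : StrictAnti D.t := strictAnti_nat_of_succ_lt D.t_lt

theorem t_zero_le : 2 * D.t 0 + D.t 1 ≤ 1 := by
  have h : (2 : K) ≤ D.a 1 := by exact_mod_cast D.two_le_a_one
  have := D.t_one
  have := D.t_pos 0
  nlinarith

theorem t_add_le (k : ℕ) : D.t (k + 1) + D.t (k + 2) ≤ D.t k := by
  have h : (1 : K) ≤ D.a (k + 2) := by exact_mod_cast D.one_le_a k
  have := D.t_rec k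
  have := D.t_pos (k + 1)
  nlinarith

/-- The points outside the subfield `F`. Such a point is never an endpoint of an interval. -/
def Generic (y : K) : Prop := y ∉ D.F

variable {D}

theorem Generic.lt_or_gt {y : K} (h : D.Generic y) {r : K} (hr : r ∈ D.F) : y < r ∨ r < y :=
  lt_or_gt_of_ne fun e => h (e ▸ hr)

theorem Generic.add {y : K} (h : D.Generic y) {r : K} (hr : r ∈ D.F) : D.Generic (y + r) :=
  fun hy => h (by simpa using D.F.sub_mem hy hr)

theorem Generic.sub {y : K} (h : D.Generic y) {r : K} (hr : r ∈ D.F) : D.Generic (y - r) :=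
  fun hy => h (by simpa using D.F.add_mem hy hr)

theorem two_mem : (2 : K) ∈ D.F := by simp

theorem Generic.half {y : K} (h : D.Generic y) : D.Generic (y / 2) :=
  fun hy => h (by simpa using D.F.mul_mem hy two_mem)

theorem Generic.neg {y : K} (h : D.Generic y) : D.Generic (-y) :=
  fun hy => h (by simpa using D.F.neg_mem hy)

variable (D)

open Classical in
/-- The letter of the point `y`; the discontinuities are at `0` and at `t 0`. -/
noncomputable def letter (y : K) : Fin 2 := if ∃ m : ℤ, 0 < y - m ∧ y - m < D.t 0 then 1 else 0

theorem letter_sub_intCast (y : K) (m : ℤ) : D.letter (y - m) = D.letter y := by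
  unfold letter
  congr 1
  apply propext
  constructor
  · rintro ⟨n, h1, h2⟩
    refine ⟨m + n, ?_, ?_⟩ <;> push_cast <;> linarith
  · rintro ⟨n, h1, h2⟩
    refine ⟨n - m, ?_, ?_⟩ <;> push_cast <;> linarith

theorem letter_eq_one {y : K} (h0 : 0 < y) (h1 : y < D.t 0) : D.letter y = 1 :=
  if_pos ⟨0, by simpa using h0, by simpa using h1⟩

theorem letter_eq_zero {y : K} (h0 : D.t 0 - 1 < y) (h1 : y < 0) : D.letter y = 0 := by
  refine if_neg ?_
  rintro ⟨m, h2, h3⟩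
  have h4 : (m : K) < 0 := by linarith
  have h5 : m ≤ -1 := by
    have : m < 0 := by exact_mod_cast h4
    omega
  have h6 : (m : K) ≤ -1 := by exact_mod_cast h5
  linarith

/-- The word `w` is a prefix of the coding of the orbit of `y`. -/
def Codes (w : BinWord) (y : K) : Prop :=
  ∀ (i : ℕ) (hi : i < w.length), w[i] = D.letter (y + i * D.t 0)

/-- Rotating `n` times moves a point by `d` on the circle. -/
def Shift (n : ℕ) (d : K) : Prop := ∃ m : ℤ, n * D.t 0 - m = d

variable {D}

theorem letter_shift {n : ℕ} {d : K} (h : D.Shift n d) (y : K) :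
    D.letter (y + n * D.t 0) = D.letter (y + d) := by
  obtain ⟨m, rfl⟩ := h
  rw [← add_sub_assoc, letter_sub_intCast]

theorem Shift.add {m n : ℕ} {c d : K} (h : D.Shift m c) (h' : D.Shift n d) :
    D.Shift (m + n) (c + d) := by
  obtain ⟨k, rfl⟩ := h
  obtain ⟨l, rfl⟩ := h'
  exact ⟨k + l, by push_cast; ring⟩

theorem Shift.mul {n : ℕ} {d : K} (h : D.Shift n d) (u : ℕ) : D.Shift (u * n) (u * d) := by
  obtain ⟨k, rfl⟩ := h
  exact ⟨u * k, by push_cast; ring⟩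

theorem Shift.mem {n : ℕ} {d : K} (h : D.Shift n d) : d ∈ D.F := by
  obtain ⟨k, rfl⟩ := h
  exact D.F.sub_mem (D.F.mul_mem (natCast_mem _ _) (D.t_mem 0)) (intCast_mem _ _)

theorem codes_nil (y : K) : D.Codes [] y := fun i hi => by simp at hi

theorem codes_shift {n : ℕ} {d : K} (h : D.Shift n d) (w : BinWord) (y : K) :
    D.Codes w (y + n * D.t 0) ↔ D.Codes w (y + d) := by
  unfold Codes
  refine forall₂_congr fun i hi => ?_
  rw [add_right_comm, letter_shift h, add_right_comm]

theorem codes_append {u v : BinWord} {y : K} :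
    D.Codes (u ++ v) y ↔ D.Codes u y ∧ D.Codes v (y + u.length * D.t 0) := by
  constructor
  · refine fun h => ⟨fun i hi => ?_, fun i hi => ?_⟩
    · rw [← h i (by simp; omega), List.getElem_append_left hi]
    · have := h (u.length + i) (by simpa using hi)
      rw [List.getElem_append_right (by omega)] at this
      simp only [Nat.add_sub_cancel_left] at this
      rw [this]
      congr 1
      push_cast
      ring
  · rintro ⟨h1, h2⟩ i hi
    rcases lt_or_ge i u.length with h | h
    · rw [List.getElem_append_left h, h1 i h]
    · rw [List.getElem_append_right h, h2 (i - u.length) (by simp at hi; omega)]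
      congr 1
      push_cast [Nat.cast_sub h]
      ring

theorem codes_append_of_shift {u v : BinWord} {y d : K} (hd : D.Shift u.length d) :
    D.Codes (u ++ v) y ↔ D.Codes u y ∧ D.Codes v (y + d) := by
  rw [codes_append, codes_shift hd]

theorem codes_singleton {c : Fin 2} {y : K} : D.Codes [c] y ↔ c = D.letter y := by
  simp [Codes]

theorem Codes.ext {u v : BinWord} {y : K} (hu : D.Codes u y) (hv : D.Codes v y)
    (h : u.length = v.length) : u = v :=
  List.ext_getElem h fun i h1 h2 => (hu i h1).trans (hv i h2).symm

/-- The word `w` codes both `y` and `y'`, so they have the same letter at every `i < |w|`. -/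
theorem Codes.letter_eq {w : BinWord} {y y' : K} (h : D.Codes w y) (h' : D.Codes w y') {i : ℕ}
    (hi : i < w.length) {d : K} (hd : D.Shift i d) : D.letter (y + d) = D.letter (y' + d) := by
  rw [← letter_shift hd, ← letter_shift hd, ← h i hi, ← h' i hi]

variable (D)

/-- The reversed standard words. -/
abbrev S (k : ℕ) : BinWord := revStandard D.a k

/-- The reversed semistandard words. -/
abbrev W (k l : ℕ) : BinWord := revSemistandard D.a k l

/-- The number `t k - l * t (k + 1)` that belongs to `W k l`. -/
def g (k l : ℕ) : K := D.t k - l * D.t (k + 1)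

theorem g_zero (k : ℕ) : D.g k 0 = D.t k := by simp [g]

theorem g_succ (k l : ℕ) : D.g k (l + 1) = D.g k l - D.t (k + 1) := by
  simp only [g]; push_cast; ring

theorem g_self (k : ℕ) : D.g k (D.a (k + 2)) = D.t (k + 2) := by
  simp [g, D.t_rec k]

theorem g_mem (k l : ℕ) : D.g k l ∈ D.F :=
  D.F.sub_mem (D.t_mem k) (D.F.mul_mem (natCast_mem _ _) (D.t_mem _))

theorem g_anti (k : ℕ) {l l' : ℕ} (h : l ≤ l') : D.g k l' ≤ D.g k l := by
  have h' : (l : K) ≤ l' := by exact_mod_cast h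
  have := D.t_pos (k + 1)
  simp only [g]
  nlinarith

theorem lt_g {k l : ℕ} (h : l < D.a (k + 2)) : D.t (k + 1) + D.t (k + 2) ≤ D.g k l := by
  have := D.g_anti k (show l + 1 ≤ D.a (k + 2) from h)
  rw [g_self, g_succ] at this
  linarith

theorem g_pos {k l : ℕ} (h : l ≤ D.a (k + 2)) : 0 < D.g k l := by
  have := D.g_anti k h
  rw [g_self] at this
  exact (D.t_pos _).trans_le this

/-- The sign `1` for odd `k` and `-1` for even `k`. -/
def e (K : Type*) [Field K] (k : ℕ) : K := (-1) ^ (k + 1)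

theorem e_succ (k : ℕ) : e K (k + 1) = -e K k := by simp [e, pow_succ]

theorem e_eq (k : ℕ) : e K k = 1 ∨ e K k = -1 := neg_one_pow_eq_or K _

theorem e_zero : e K 0 = -1 := by simp [e]

theorem e_one : e K 1 = 1 := by simp [e]

theorem e_mul_self (k : ℕ) : e K k * e K k = 1 := by
  rcases e_eq (K := K) k with h | h <;> rw [h] <;> ring

theorem e_mul_mul (k : ℕ) (y : K) : e K k * (e K k * y) = y := by
  rw [← mul_assoc, e_mul_self, one_mul]

theorem abs_e_mul (k : ℕ) (y : K) : |e K k * y| = |y| := by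
  rcases e_eq (K := K) k with h | h <;> rw [h] <;> simp

variable {D} in
theorem Generic.e_mul {y : K} (h : D.Generic y) (k : ℕ) : D.Generic (e K k * y) := by
  rcases e_eq (K := K) k with h' | h' <;> rw [h']
  · simpa using h
  · simpa using h.neg

theorem shift_S (k : ℕ) : D.Shift (D.S k).length (-(e K k * D.t k)) := by
  induction k using Nat.twoStepInduction with
  | zero => exact ⟨0, by simp [S, revStandard, e]⟩
  | one =>
    refine ⟨1, ?_⟩
    rw [S, length_revStandard_one _ D.two_le_a_one, e_one, D.t_one]
    push_cast
    ring
  | more k ih1 ih2 =>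
    rw [S, length_revStandard_add_two]
    have := ih1.add (ih2.mul (D.a (k + 2)))
    convert this using 1
    rw [D.t_rec, e_succ, e_succ]
    ring

theorem shift_W (k l : ℕ) : D.Shift (D.W k l).length (-(e K k * D.g k l)) := by
  rw [W, length_revSemistandard]
  convert (D.shift_S k).add ((D.shift_S (k + 1)).mul l) using 1
  rw [g, e_succ]
  ring

theorem shift_S_succ (k : ℕ) : D.Shift (D.S (k + 1)).length (e K k * D.t (k + 1)) := by
  convert D.shift_S (k + 1) using 1
  rw [e_succ]
  ring

theorem codes_S_zero {y : K} (h0 : D.t 0 - 1 < y) (h1 : y < 0) : D.Codes (D.S 0) y :=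
  codes_singleton.2 (D.letter_eq_zero h0 h1).symm

theorem codes_S_one {y : K} (h0 : 0 < y) (h1 : y < D.t 0) : D.Codes (D.S 1) y := by
  have s1 : D.Shift ([1] : BinWord).length (D.t 0 - 1) := ⟨1, by simp⟩
  refine (codes_append_of_shift s1).2 ⟨codes_singleton.2 (D.letter_eq_one h0 h1).symm, ?_⟩
  intro i hi
  simp only [List.length_replicate] at hi
  rw [List.getElem_replicate, D.letter_eq_zero]
  · have : (0 : K) ≤ i * D.t 0 := mul_nonneg (Nat.cast_nonneg _) (D.t_pos 0).le
    linarith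
  · have h2 : (i + 2 : K) ≤ D.a 1 := by exact_mod_cast (by omega : i + 2 ≤ D.a 1)
    have h3 := D.t_one
    have h4 := D.t_pos 1
    have h5 := D.t_pos 0
    nlinarith

/-- The intervals coded by the words `W k l` and `S (k + 1)`. -/
structure CodesStage (k l : ℕ) : Prop where
  left : ∀ z, D.Generic z → 0 < z → z < D.g k l + D.t (k + 1) → D.Codes (D.W k l) (e K k * z)
  right : ∀ z, D.Generic z → -(D.g k l + D.t (k + 1)) < z → z < 0 →
    D.Codes (D.S (k + 1)) (e K k * z)

variable {D} in
-- Reading `W k l` lowers `z` by `g k l`. For `z < g k l` the image is negative and within the range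
-- of `S (k + 1)`, which can be appended.
theorem CodesStage.succ {k l : ℕ} (h : D.CodesStage k l) : D.CodesStage k (l + 1) := by
  have hp := D.t_pos (k + 1)
  refine ⟨fun z hz h0 h1 => ?_, fun z hz h0 h1 => ?_⟩
  · rw [g_succ] at h1
    rw [W, revSemistandard_succ, codes_append_of_shift (D.shift_W k l)]
    refine ⟨h.left z hz h0 (by linarith), ?_⟩
    convert h.right (z - D.g k l) (hz.sub (D.g_mem k l)) (by linarith) (by linarith) using 1
    ring
  · rw [g_succ] at h0
    exact h.right z hz (by linarith) h1

variable {D} in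
theorem CodesStage.add {k l : ℕ} (h : D.CodesStage k l) (n : ℕ) : D.CodesStage k (l + n) := by
  induction n with
  | zero => exact h
  | succ n ih => exact ih.succ

variable {D} in
-- At `l = a (k + 2)` the word `W k l` is `S (k + 2)`, so the two words exchange roles; the
-- reflection `z ↦ -z` absorbs the change of sign from `e K k` to `e K (k + 1)`.
theorem CodesStage.next {k : ℕ} (h : D.CodesStage k (D.a (k + 2))) : D.CodesStage (k + 1) 0 := by
  refine ⟨fun z hz h0 h1 => ?_, fun z hz h0 h1 => ?_⟩
  · rw [g_zero] at h1
    rw [W, revSemistandard_zero]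
    convert h.right (-z) hz.neg (by rw [g_self]; linarith) (by linarith) using 1
    rw [e_succ]; ring
  · rw [g_zero] at h0
    convert h.left (-z) hz.neg (by linarith) (by rw [g_self]; linarith) using 1
    · exact (revSemistandard_self _ _).symm
    · rw [e_succ]; ring

/-- The induction has to start at `l = 1`: stage `(0, 0)` would have `S 1` coding points up to `t 0
+ t 1`, past the discontinuity `t 0`. -/
theorem codesStage_zero_one : D.CodesStage 0 1 := by
  have h0 := D.t_zero_le
  have h1 := D.t_pos 1
  have hg : D.g 0 1 + D.t 1 = D.t 0 := by simp [g]
  refine ⟨fun z hz hz0 hz1 => ?_, fun z hz hz0 hz1 => ?_⟩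
  · rw [hg] at hz1
    rw [e_zero, W, revSemistandard_succ, revSemistandard_zero,
      codes_append_of_shift (D.shift_S 0), e_zero]
    exact ⟨D.codes_S_zero (by linarith) (by linarith), D.codes_S_one (by linarith) (by linarith)⟩
  · rw [hg] at hz0
    rw [e_zero]
    exact D.codes_S_one (by linarith) (by linarith)

theorem codesStage_zero (l : ℕ) : D.CodesStage 0 (l + 1) := by
  rw [add_comm]
  exact D.codesStage_zero_one.add l

theorem codesStage_succ (k l : ℕ) : D.CodesStage (k + 1) l := by
  induction k generalizing l with
  | zero =>
    obtain ⟨n, hn⟩ := Nat.exists_eq_add_of_le' (D.one_le_a 0)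
    have : D.CodesStage 0 (D.a (0 + 2)) := by rw [hn]; exact D.codesStage_zero n
    simpa using this.next.add l
  | succ k ih => simpa using (ih (D.a (k + 1 + 2))).next.add l

theorem codesStage {k l : ℕ} (h : 1 ≤ k ∨ 1 ≤ l) : D.CodesStage k l := by
  rcases k with _ | k
  · obtain ⟨n, rfl⟩ := Nat.exists_eq_add_of_le' (by omega : 1 ≤ l)
    exact D.codesStage_zero n
  · exact D.codesStage_succ k l

end RotationData

end Sturmian

/-! ### Parsing into squares of minimal square roots -/

namespace Sturmian

namespace RotationData

variable {K : Type*} [Field K] [LinearOrder K] [IsStrictOrderedRing K] (D : RotationData K)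

/-- The minimal square roots. -/
abbrev roots : Set BinWord := minimalSquareRoots (D.a 1 - 1) (D.a 2 - 1)

/-- The word `0 1 0 ^ (a 1 - 2)`, which is `S 1` with its first two letters exchanged. -/
abbrev swappedOne : BinWord := [0] ++ ([1] ++ List.replicate (D.a 1 - 2) 0)

/-- The word `S (k + 2)` with its first two letters exchanged. -/
abbrev swapped (k : ℕ) : BinWord := D.S (k + 1) ++ D.W k (D.a (k + 2) - 1)

theorem mem_roots_iff (w : BinWord) : w ∈ D.roots ↔ w = D.S 0 ∨ w = D.swappedOne ∨
    w = D.W 0 1 ∨ w = D.S 1 ∨ w = D.swapped 0 ∨ w = D.W 1 1 := by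
  have h1 : D.a 1 - 1 - 1 = D.a 1 - 2 := by omega
  have h2 : D.a 2 - 1 + 1 = D.a 2 := Nat.sub_add_cancel (D.one_le_a 0)
  simp only [roots, minimalSquareRoots, Set.mem_insert_iff, Set.mem_singleton_iff, h1, h2]
  simp [S, W, swapped, revSemistandard, revStandard, BinWord.pow_one', List.replicate_succ']

theorem length_swappedOne : D.swappedOne.length = (D.S 1).length := by
  have := D.two_le_a_one
  rw [S, length_revStandard_one _ this]
  simp
  omega

theorem length_swapped (k : ℕ) : (D.swapped k).length = (D.S (k + 2)).length := by
  obtain ⟨n, hn⟩ := Nat.exists_eq_add_of_le' (D.one_le_a k)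
  rw [List.length_append, length_revSemistandard, length_revStandard_add_two, hn]
  simp
  ring

theorem codes_W {k l : ℕ} (hl : l ≤ D.a (k + 2)) {z : K} (hz : D.Generic z) (h0 : 0 < z)
    (h1 : z < D.t (k + 1)) : D.Codes (D.W k l) (e K k * z) := by
  by_cases h : 1 ≤ k ∨ 1 ≤ l
  · have := D.g_pos hl
    exact (D.codesStage h).left z hz h0 (by linarith)
  · obtain ⟨rfl, rfl⟩ : k = 0 ∧ l = 0 := by omega
    have := D.t_zero_le
    have := D.t_pos 0
    rw [W, revSemistandard_zero, e_zero]
    exact D.codes_S_zero (by linarith) (by linarith)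

/-- These points lie on the side of `0` opposite to the one where `S (k + 2)` is read. There `S (k +
1)` comes first and carries the point across `0`, and then `W k (a (k + 2) - 1)` is read. -/
theorem codes_swapped (k : ℕ) {z : K} (hz : D.Generic z) (h0 : 0 < z) (h1 : z < D.t (k + 1)) :
    D.Codes (D.swapped k) (e K (k + 1) * z) := by
  rw [codes_append_of_shift (D.shift_S (k + 1))]
  constructor
  · have := (D.codesStage (Or.inr (D.one_le_a k))).right (-z) hz.neg
      (by linarith [D.g_pos (k := k) le_rfl]) (by linarith)
    convert this using 1
    rw [e_succ]; ring
  · convert D.codes_W (k := k) (l := D.a (k + 2) - 1) (by omega) (z := -(z - D.t (k + 1)))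
      (hz.sub (D.t_mem _)).neg (by linarith) (by linarith) using 1
    rw [e_succ]; ring

theorem codes_swappedOne {y : K} (h0 : -D.t 0 < y) (h1 : y < 0) : D.Codes D.swappedOne y := by
  have h2 := D.t_zero_le
  have h3 := D.t_pos 1
  have s : D.Shift ([0] : BinWord).length (D.t 0) := ⟨0, by simp⟩
  rw [codes_append_of_shift s]
  refine ⟨D.codes_S_zero (by linarith) h1, ?_⟩
  have h4 : D.S 1 = ([1] ++ List.replicate (D.a 1 - 2) 0) ++ [0] := by
    have : D.a 1 - 1 = D.a 1 - 2 + 1 := by have := D.two_le_a_one; omega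
    simp [S, revStandard, this, List.replicate_succ']
  have h5 := D.codes_S_one (y := y + D.t 0) (by linarith) (by linarith)
  rw [h4, codes_append] at h5
  exact h5.1

variable {D} in
theorem sum_length_squares (Y : List BinWord) :
    (Y.map fun w => w ++ w).flatten.length = 2 * Y.flatten.length := by
  induction Y with
  | nil => rfl
  | cons w Y ih => simp only [List.map_cons, List.flatten_cons, List.length_append, ih]; ring

/-- The coding of `y` starts with a product of squares of minimal square roots, the product of
these roots has length `n`, and it is a prefix of the coding of `y / 2`. -/
def Parses (y : K) (n : ℕ) : Prop :=
  ∃ Y : List BinWord, (∀ w ∈ Y, w ∈ D.roots) ∧ Y.flatten.length = n ∧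
    D.Codes (Y.map fun w => w ++ w).flatten y ∧ D.Codes Y.flatten (y / 2)

variable {D}

/-- Reading the squares moves `y` by `2 * d` while reading the roots moves `y / 2` by `d`, so the
second point remains half of the first. -/
theorem Parses.trans {y d : K} {m n : ℕ} (h : D.Parses y m) (hd : D.Shift m d)
    (h' : D.Parses (y + 2 * d) n) : D.Parses y (m + n) := by
  obtain ⟨Y, hY, rfl, h1, h2⟩ := h
  obtain ⟨Z, hZ, rfl, h3, h4⟩ := h'
  refine ⟨Y ++ Z, ?_, by simp, ?_, ?_⟩
  · intro w hw
    rcases List.mem_append.1 hw with h | h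
    exacts [hY w h, hZ w h]
  · rw [List.map_append, List.flatten_append]
    refine (codes_append_of_shift (d := 2 * d) ?_).2 ⟨h1, h3⟩
    rw [sum_length_squares]
    exact_mod_cast hd.mul 2
  · rw [List.flatten_append, codes_append_of_shift hd]
    refine ⟨h2, ?_⟩
    convert h4 using 1
    ring

theorem parses_of_mem_roots {w : BinWord} {y d : K} (hw : w ∈ D.roots) (hd : D.Shift w.length d)
    (h1 : D.Codes w y) (h2 : D.Codes w (y + d)) (h3 : D.Codes w (y / 2)) :
    D.Parses y w.length := by
  refine ⟨[w], by simpa using hw, by simp, ?_, by simpa using h3⟩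
  simpa using! (codes_append_of_shift hd).2 ⟨h1, h2⟩

variable (D)

theorem parses_S_zero {y : K} (h0 : D.t 0 - 1 < y) (h1 : y < -D.t 0) :
    D.Parses y (D.S 0).length := by
  have h2 := D.t_pos 0
  have h3 := D.t_zero_le
  have h4 := D.t_pos 1
  refine parses_of_mem_roots ((D.mem_roots_iff _).2 (Or.inl rfl)) (D.shift_S 0)
    (D.codes_S_zero h0 (by linarith)) (D.codes_S_zero ?_ ?_) (D.codes_S_zero ?_ ?_) <;>
  · try rw [e_zero]
    linarith

theorem parses_swappedOne {y : K} (h0 : -(D.t 0 - D.t 1) < y) (h1 : y < 0) :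
    D.Parses y (D.S 1).length := by
  have h2 := D.t_pos 1
  rw [← length_swappedOne]
  refine parses_of_mem_roots ((D.mem_roots_iff _).2 (by simp)) (d := -D.t 1) ?_
    (D.codes_swappedOne ?_ ?_) (D.codes_swappedOne ?_ ?_) (D.codes_swappedOne ?_ ?_)
  · rw [length_swappedOne]
    convert D.shift_S 1 using 1
    rw [e_one]; ring
  all_goals linarith

theorem parses_S_one {y : K} (h0 : D.t 1 < y) (h1 : y < D.t 0) :
    D.Parses y (D.S 1).length := by
  have h2 := D.t_pos 1
  refine parses_of_mem_roots ((D.mem_roots_iff _).2 (by simp)) (D.shift_S 1)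
    (D.codes_S_one ?_ ?_) (D.codes_S_one ?_ ?_) (D.codes_S_one ?_ ?_) <;>
  · try rw [e_one]
    linarith

theorem parses_root_W {k l : ℕ} (hw : D.W k l ∈ D.roots) (hl : 1 ≤ l) (hl' : l ≤ D.a (k + 2))
    {z : K} (hz : D.Generic z) (h0 : D.g k l < z) (h1 : z < D.g k l + D.t (k + 1)) :
    D.Parses (e K k * z) (D.W k l).length := by
  have hg := D.g_pos hl'
  have hh := D.t_pos (k + 1)
  have hs := D.codesStage (k := k) (Or.inr hl)
  refine parses_of_mem_roots hw (D.shift_W k l) (hs.left z hz (by linarith) h1) ?_ ?_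
  · convert hs.left (z - D.g k l) (hz.sub (D.g_mem _ _)) (by linarith) (by linarith) using 1
    ring
  · convert hs.left (z / 2) hz.half (by linarith) (by linarith) using 1
    ring

theorem parses_swapped_zero {y : K} (hy : D.Generic y) (h0 : 0 < y) (h1 : y < D.t 1 - D.t 2) :
    D.Parses y (D.S 2).length := by
  have h2 := D.t_pos 2
  have key : ∀ z, D.Generic z → 0 < z → z < D.t 1 → D.Codes (D.swapped 0) z := by
    intro z hz hz0 hz1
    simpa [e_one] using D.codes_swapped 0 hz hz0 hz1
  rw [← length_swapped]
  refine parses_of_mem_roots ((D.mem_roots_iff _).2 (by simp)) (d := D.t 2) ?_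
    (key _ hy ?_ ?_) (key _ (hy.add (D.t_mem 2)) ?_ ?_) (key _ hy.half ?_ ?_)
  · rw [length_swapped]
    convert D.shift_S 2 using 1
    rw [e_succ, e_one]; ring
  all_goals linarith

/-- The points that parse at the length of `W k l` and at the length of `S (k + 1)`. -/
structure ParsesStage (k l : ℕ) : Prop where
  left : ∀ z, D.Generic z → D.g k l - D.t (k + 1) < z → z < D.g k l + D.t (k + 1) →
    D.Parses (e K k * z) (D.W k l).length
  right : ∀ z, D.Generic z → -(D.g k l + D.t (k + 1)) < z → z < D.g k l - D.t (k + 1) →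
    D.Parses (e K k * z) (D.S (k + 1)).length

/-- The version of `ParsesStage` for `k = 0`, where the intervals are smaller. -/
structure ParsesStageZero (l : ℕ) : Prop where
  left : ∀ z, D.Generic z → D.g 0 l - D.t 1 < z → 0 < z → z < D.g 0 l + D.t 1 →
    D.Parses (-z) (D.W 0 l).length
  right : ∀ z, D.Generic z → (-(D.g 0 l + D.t 1) < z ∧ z < -D.t 1 ∨
    0 < z ∧ z < D.g 0 l - D.t 1) → D.Parses (-z) (D.S 1).length

theorem shift_W_zero (l : ℕ) : D.Shift (D.W 0 l).length (D.g 0 l) := by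
  convert D.shift_W 0 l using 1
  rw [e_zero]; ring

theorem shift_S_one : D.Shift (D.S 1).length (-D.t 1) := by
  convert D.shift_S 1 using 1
  rw [e_one]; ring

theorem parsesStageZero_one : D.ParsesStageZero 1 := by
  have h0 := D.t_zero_le
  have h1 := D.t_pos 1
  have hg : D.g 0 1 = D.t 0 - D.t 1 := by simp [g]
  refine ⟨fun z hz hz0 hz1 hz2 => ?_, fun z hz hz0 => ?_⟩
  · rcases hz.lt_or_gt (D.g_mem 0 1) with h | h
    · rw [W, revSemistandard_succ, revSemistandard_zero, List.length_append, add_comm]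
      rw [hg] at *
      refine (D.parses_swappedOne (by linarith) (by linarith)).trans D.shift_S_one
        (D.parses_S_zero ?_ ?_) <;> linarith
    · have := D.parses_root_W ((D.mem_roots_iff _).2 (by simp)) le_rfl (D.one_le_a 0) hz h hz2
      rwa [e_zero, neg_one_mul] at this
  · rw [hg] at hz0
    rcases hz0 with ⟨h2, h3⟩ | ⟨h2, h3⟩
    · exact D.parses_S_one (by linarith) (by linarith)
    · exact D.parses_swappedOne (by linarith) (by linarith)

variable {D} in
theorem ParsesStageZero.succ {l : ℕ} (h : D.ParsesStageZero l) (hl : l < D.a 2) :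
    D.ParsesStageZero (l + 1) := by
  have h1 := D.t_pos 1
  have h2 := D.t_pos 2
  have hg := D.lt_g (k := 0) hl
  simp only [zero_add] at hg
  refine ⟨fun z hz hz0 hz1 hz2 => ?_, fun z hz hz0 => ?_⟩
  · rw [g_succ] at hz0 hz2
    simp only [zero_add] at hz0 hz2
    rw [W, revSemistandard_succ, List.length_append]
    rcases hz.lt_or_gt (D.F.sub_mem (D.g_mem 0 l) (D.t_mem 1)) with h3 | h3
    · rw [add_comm]
      refine (h.right z hz (Or.inr ⟨hz1, h3⟩)).trans D.shift_S_one ?_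
      convert h.left (z + 2 * D.t 1) (hz.add (D.F.mul_mem two_mem (D.t_mem 1))) (by linarith)
        (by linarith) (by linarith) using 1
      ring
    · refine (h.left z hz h3 hz1 (by linarith)).trans (D.shift_W_zero l) ?_
      convert h.right (z - 2 * D.g 0 l) (hz.sub (D.F.mul_mem two_mem (D.g_mem 0 l)))
        (Or.inl ⟨by linarith, by linarith⟩) using 1
      ring
  · rw [g_succ] at hz0
    simp only [zero_add] at hz0
    refine h.right z hz ?_
    rcases hz0 with ⟨h4, h5⟩ | ⟨h4, h5⟩
    · exact Or.inl ⟨by linarith, h5⟩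
    · exact Or.inr ⟨h4, by linarith⟩

theorem parsesStageZero {l : ℕ} (hl : l + 1 ≤ D.a 2) : D.ParsesStageZero (l + 1) := by
  induction l with
  | zero => exact D.parsesStageZero_one
  | succ l ih => exact (ih (by omega)).succ (by omega)

/-- The gap `(0, t 1)` left by `ParsesStageZero` is filled here by the two long minimal roots:
`swapped 0` parses up to `t 1 - t 2`, and `W 1 1` parses between `t 1 - t 2` and `t 1`. From this
stage on the induction is uniform. -/
theorem parsesStage_one_one : D.ParsesStage 1 1 := by
  have h0 : D.ParsesStageZero (D.a 2) := by
    obtain ⟨n, hn⟩ := Nat.exists_eq_add_of_le' (D.one_le_a 0)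
    rw [zero_add] at hn
    rw [hn]
    exact D.parsesStageZero hn.ge
  have h1 := D.t_lt 1
  have h2 := D.t_pos 2
  have hg0 : D.g 0 (D.a 2) = D.t 2 := D.g_self 0
  have hW : D.W 0 (D.a 2) = D.S 2 := revSemistandard_self _ 0
  have hg : D.g 1 1 = D.t 1 - D.t 2 := by simp [g]
  have key : ∀ z, D.Generic z → -D.t 1 < z → z < D.t 1 - D.t 2 →
      D.Parses z (D.S 2).length := by
    intro z hz hz0 hz1
    rcases hz.lt_or_gt D.F.zero_mem with h | h
    · have := h0.left (-z) hz.neg (by rw [hg0]; linarith) (by linarith) (by rw [hg0]; linarith)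
      rwa [neg_neg, hW] at this
    · exact D.parses_swapped_zero hz h hz1
  refine ⟨fun z hz hz0 hz1 => ?_, fun z hz hz0 hz1 => ?_⟩
  · rcases hz.lt_or_gt (D.g_mem 1 1) with h | h
    · rw [e_one, one_mul, W, revSemistandard_succ, revSemistandard_zero, List.length_append,
        add_comm]
      rw [hg] at *
      simp only [Nat.reduceAdd] at *
      refine (key z hz (by linarith) (by linarith)).trans (d := D.t 2) ?_ ?_
      · convert D.shift_S 2 using 1
        rw [e_succ, e_one]; ring
      · convert h0.right (-(z + 2 * D.t 2)) (hz.add (D.F.mul_mem two_mem (D.t_mem 2))).neg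
          (Or.inl ⟨by rw [hg0]; linarith, by linarith⟩) using 1
        ring
    · exact D.parses_root_W ((D.mem_roots_iff _).2 (by simp)) le_rfl (D.one_le_a 1) hz h hz1
  · rw [hg] at *
    simp only [Nat.reduceAdd] at *
    rw [e_one, one_mul]
    exact key z hz (by linarith) (by linarith)

variable {D} in
-- Stage `(k, l)` describes an exchange of two intervals on `(-(g + t), g + t)`, where `g = g k l`
-- and `t = t (k + 1)`: `z` goes to `z - 2g` on the upper part and to `z + 2t` on the lower. This is
-- the induced map on `(-g, g)`; either order of the two pieces gives the same total length, which
-- is all that `Parses` records.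
theorem ParsesStage.succ {k l : ℕ} (h : D.ParsesStage k l) (hl : l < D.a (k + 2)) :
    D.ParsesStage k (l + 1) := by
  have h1 := D.t_pos (k + 1)
  have h2 := D.t_pos (k + 2)
  have hg := D.lt_g (k := k) hl
  refine ⟨fun z hz hz0 hz1 => ?_, fun z hz hz0 hz1 => ?_⟩
  · rw [g_succ] at hz0 hz1
    rw [W, revSemistandard_succ, List.length_append]
    rcases hz.lt_or_gt (D.F.sub_mem (D.g_mem k l) (D.t_mem (k + 1))) with h3 | h3
    · rw [add_comm]
      refine (h.right z hz (by linarith) h3).trans (D.shift_S_succ k) ?_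
      convert h.left (z + 2 * D.t (k + 1)) (hz.add (D.F.mul_mem two_mem (D.t_mem _)))
        (by linarith) (by linarith) using 1
      ring
    · refine (h.left z hz h3 (by linarith)).trans (D.shift_W k l) ?_
      convert h.right (z - 2 * D.g k l) (hz.sub (D.F.mul_mem two_mem (D.g_mem k l)))
        (by linarith) (by linarith) using 1
      ring
  · rw [g_succ] at hz0 hz1
    exact h.right z hz (by linarith) (by linarith)

variable {D} in
theorem ParsesStage.add {k l n : ℕ} (h : D.ParsesStage k l) (hl : l + n ≤ D.a (k + 2)) :
    D.ParsesStage k (l + n) := by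
  induction n with
  | zero => exact h
  | succ n ih => exact (ih (by omega)).succ (by omega)

variable {D} in
theorem ParsesStage.next {k : ℕ} (h : D.ParsesStage k (D.a (k + 2))) :
    D.ParsesStage (k + 1) 0 := by
  refine ⟨fun z hz h0 h1 => ?_, fun z hz h0 h1 => ?_⟩
  · rw [g_zero] at h0 h1
    rw [W, revSemistandard_zero]
    convert h.right (-z) hz.neg (by rw [g_self]; linarith) (by rw [g_self]; linarith) using 1
    rw [e_succ]; ring
  · rw [g_zero] at h0 h1
    convert h.left (-z) hz.neg (by rw [g_self]; linarith) (by rw [g_self]; linarith) using 1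
    · rw [e_succ]; ring
    · exact congrArg List.length (revSemistandard_self _ _).symm

theorem parsesStage_one {l : ℕ} (hl : l + 1 ≤ D.a 3) : D.ParsesStage 1 (l + 1) := by
  rw [add_comm] at hl ⊢
  exact D.parsesStage_one_one.add hl

theorem parsesStage_add_two {k l : ℕ} (hl : l ≤ D.a (k + 4)) : D.ParsesStage (k + 2) l := by
  induction k generalizing l with
  | zero =>
    obtain ⟨n, hn⟩ := Nat.exists_eq_add_of_le' (D.one_le_a 1)
    have : D.ParsesStage 1 (D.a (1 + 2)) := by rw [hn]; exact D.parsesStage_one hn.ge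
    simpa using this.next.add (n := l) (by simpa using hl)
  | succ k ih =>
    simpa using (ih (l := D.a (k + 1 + 3)) le_rfl).next.add (n := l) (by simpa using hl)

theorem parses_W {k l : ℕ} (hl : 1 ≤ l) (hl' : l ≤ D.a (k + 2)) {z : K} (hz : D.Generic z)
    (h0 : D.g k l < z) (h1 : z < D.g k l + D.t (k + 1)) :
    D.Parses (e K k * z) (D.W k l).length := by
  have hg := D.g_pos hl'
  have ht := D.t_pos (k + 1)
  obtain ⟨n, rfl⟩ := Nat.exists_eq_add_of_le' hl
  rcases k with _ | _ | k
  · rw [e_zero, neg_one_mul]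
    rw [zero_add] at ht
    exact (D.parsesStageZero hl').left z hz (by linarith) (by linarith) h1
  · exact (D.parsesStage_one hl').left z hz (by linarith) h1
  · exact (D.parsesStage_add_two hl').left z hz (by linarith) h1

theorem parses_swapped (k : ℕ) {z : K} (hz : D.Generic z) (h0 : 0 < z)
    (h1 : z < D.t (k + 2) - D.t (k + 3)) :
    D.Parses (e K (k + 2) * z) (D.S (k + 3)).length := by
  have := D.t_pos (k + 2)
  have := D.t_pos (k + 3)
  refine (D.parsesStage_add_two (Nat.zero_le _)).right z hz ?_ ?_ <;> rw [g_zero] <;> linarith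

/-- A point of the interval `(t 0 - 1, t 0)`, in which the letter of a point is given by its
sign. -/
def InWindow (y : K) : Prop := D.t 0 - 1 < y ∧ y < D.t 0

variable {D}

theorem InWindow.half {y : K} (h : D.InWindow y) : D.InWindow (y / 2) := by
  have := D.t_zero_le
  have := D.t_pos 0
  have := D.t_pos 1
  obtain ⟨h1, h2⟩ := h
  constructor <;> linarith

theorem InWindow.neg_of_letter {y : K} (h : D.InWindow y) (hy : D.Generic y)
    (hl : 0 = D.letter y) : y < 0 := by
  refine (hy.lt_or_gt D.F.zero_mem).resolve_right fun h0 => ?_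
  rw [D.letter_eq_one h0 h.2] at hl
  exact absurd hl (by decide)

theorem InWindow.pos_of_letter {y : K} (h : D.InWindow y) (hy : D.Generic y)
    (hl : 1 = D.letter y) : 0 < y := by
  refine (hy.lt_or_gt D.F.zero_mem).resolve_left fun h0 => ?_
  rw [D.letter_eq_zero h.1 h0] at hl
  exact absurd hl (by decide)

/-- The square of a minimal square root determines the interval of a point. -/
theorem half_of_mem_roots {w : BinWord} {y : K} (hw : w ∈ D.roots) (hy : D.Generic y)
    (hwin : D.InWindow y) (h : D.Codes (w ++ w) y) :
    D.Codes w (y / 2) ∧ ∃ d, D.Shift w.length d ∧ D.InWindow (y + 2 * d) := by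
  have p0 := D.t_pos 0
  have p1 := D.t_pos 1
  have p2 := D.t_pos 2
  have l0 := D.t_lt 0
  have l1 := D.t_lt 1
  have hz := D.t_zero_le
  have ha := D.t_add_le 0
  simp only [zero_add] at l0 l1 ha
  obtain ⟨w1, w2⟩ := hwin
  have zero_one : ∀ {v : BinWord} {x : K}, D.Generic x → D.InWindow x →
      D.Codes ([0] ++ ([1] ++ v)) x → x < 0 ∧ -D.t 0 < x := by
    intro v x hx hxw hv
    have s : D.Shift ([0] : BinWord).length (D.t 0) := ⟨0, by simp⟩
    rw [codes_append_of_shift s, codes_append, codes_singleton, codes_singleton] at hv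
    have hneg := hxw.neg_of_letter hx hv.1
    obtain ⟨hx1, hx2⟩ := hxw
    have := InWindow.pos_of_letter ⟨by linarith, by linarith⟩ (hx.add (D.t_mem 0)) hv.2.1
    exact ⟨hneg, by linarith⟩
  -- For each root, a few letters near the start of the two copies or near a return to `0` already
  -- confine `y` enough: `y / 2` falls into the interval of the root, and `y + 2 * d` stays in the
  -- window.
  rcases (D.mem_roots_iff w).1 hw with rfl | rfl | rfl | rfl | rfl | rfl
  · have s : D.Shift (D.S 0).length (D.t 0) := ⟨0, by simp [revStandard]⟩
    rw [codes_append_of_shift s] at h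
    have h0 := InWindow.neg_of_letter ⟨w1, w2⟩ hy (codes_singleton.1 h.1)
    have h1 := InWindow.neg_of_letter ⟨by linarith, by linarith⟩ (hy.add (D.t_mem 0))
      (codes_singleton.1 h.2)
    exact ⟨D.codes_S_zero (by linarith) (by linarith), _, s, by linarith, by linarith⟩
  · have s : D.Shift D.swappedOne.length (-D.t 1) := by
      rw [length_swappedOne]; exact D.shift_S_one
    rw [codes_append_of_shift s] at h
    obtain ⟨h0, h1⟩ := zero_one hy ⟨w1, w2⟩ h.1
    obtain ⟨h2, h3⟩ := zero_one (hy.add (D.F.neg_mem (D.t_mem 1)))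
      ⟨by linarith, by linarith⟩ h.2
    exact ⟨D.codes_swappedOne (by linarith) (by linarith), _, s, by linarith, by linarith⟩
  · have hg : D.g 0 1 = D.t 0 - D.t 1 := by simp [g]
    have s := D.shift_W_zero 1
    rw [codes_append_of_shift s] at h
    have hW : D.W 0 1 = [0] ++ ([1] ++ List.replicate (D.a 1 - 1) 0) := by
      simp [revSemistandard, revStandard, BinWord.pow_one']
    rw [hW] at h
    obtain ⟨h0, h1⟩ := zero_one hy ⟨w1, w2⟩ h.1
    have h' := h.2
    rw [hg, codes_append, codes_singleton] at h'
    have h2 := InWindow.neg_of_letter ⟨by linarith, by linarith⟩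
      (hy.add (D.F.sub_mem (D.t_mem 0) (D.t_mem 1))) h'.1
    rw [hg] at s
    refine ⟨?_, _, s, by linarith, by linarith⟩
    have := (D.codesStage_zero_one).left (-y / 2) hy.neg.half (by linarith)
      (by rw [hg]; simp only [zero_add]; linarith)
    rw [e_zero] at this
    convert this using 1
    ring
  · rw [codes_append_of_shift D.shift_S_one] at h
    have h' := h
    simp only [S, revStandard, codes_append, codes_singleton] at h'
    have h0 := InWindow.pos_of_letter ⟨w1, w2⟩ hy h'.1.1
    have h1 := InWindow.pos_of_letter ⟨by linarith, by linarith⟩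
      (hy.add (D.F.neg_mem (D.t_mem 1))) h'.2.1
    exact ⟨D.codes_S_one (by linarith) (by linarith), _, D.shift_S_one, by linarith,
      by linarith⟩
  · have key : ∀ {x : K}, D.Generic x → D.InWindow x → D.Codes (D.swapped 0) x →
        0 < x ∧ x < D.t 1 := by
      intro x hx hxw hc
      rw [codes_append_of_shift D.shift_S_one, W, revSemistandard, revStandard, codes_append,
        codes_singleton] at hc
      have hc' := hc.1
      simp only [S, revStandard, codes_append, codes_singleton] at hc'
      have hpos := hxw.pos_of_letter hx hc'.1
      have := InWindow.neg_of_letter (D := D) (y := x + -D.t 1)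
        ⟨by linarith, by linarith [hxw.2]⟩ (hx.add (D.F.neg_mem (D.t_mem 1))) hc.2.1
      exact ⟨hpos, by linarith⟩
    have s : D.Shift (D.swapped 0).length (D.t 2) := by
      rw [length_swapped]
      convert D.shift_S 2 using 1
      rw [e_succ, e_one]; ring
    rw [codes_append_of_shift s] at h
    obtain ⟨h0, h1⟩ := key hy ⟨w1, w2⟩ h.1
    obtain ⟨h2, h3⟩ := key (hy.add (D.t_mem 2)) ⟨by linarith, by linarith⟩ h.2
    refine ⟨?_, _, s, by linarith, by linarith⟩
    have := D.codes_swapped 0 hy.half (by linarith) (by simp only [zero_add]; linarith)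
    rwa [zero_add, e_one, one_mul] at this
  · have hg : D.g 1 1 = D.t 1 - D.t 2 := by simp [g]
    have s : D.Shift (D.W 1 1).length (-(D.t 1 - D.t 2)) := by
      convert D.shift_W 1 1 using 1
      rw [e_one, hg]; ring
    rw [codes_append_of_shift s] at h
    have hW : D.W 1 1 = D.S 1 ++ ([0] ++ BinWord.pow (D.S 1) (D.a 2)) := by
      simp [revSemistandard, revStandard, BinWord.pow_one']
    rw [hW, codes_append_of_shift D.shift_S_one, codes_append (u := [0]), codes_singleton] at h
    have h' := h
    simp only [S, revStandard, codes_append, codes_singleton] at h'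
    have h0 := InWindow.pos_of_letter ⟨w1, w2⟩ hy h'.1.1.1
    have h1 := InWindow.neg_of_letter (D := D) (y := y + -D.t 1) ⟨by linarith, by linarith⟩
      (hy.add (D.F.neg_mem (D.t_mem 1))) h.1.2.1
    have h2 := InWindow.pos_of_letter (D := D) (y := y + -(D.t 1 - D.t 2))
      ⟨by linarith, by linarith⟩
      (hy.add (D.F.neg_mem (D.F.sub_mem (D.t_mem 1) (D.t_mem 2)))) h'.2.1.1
    refine ⟨?_, _, s, by linarith, by linarith⟩
    have := (D.codesStage (k := 1) (l := 1) (by simp)).left (y / 2) hy.half (by linarith)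
      (by rw [hg]; simp only [Nat.reduceAdd]; linarith)
    rwa [e_one, one_mul] at this

theorem codes_half_of_squares {Y : List BinWord} {y : K} (hY : ∀ w ∈ Y, w ∈ D.roots)
    (hy : D.Generic y) (hwin : D.InWindow y) (h : D.Codes (Y.map fun w => w ++ w).flatten y) :
    D.Codes Y.flatten (y / 2) := by
  induction Y generalizing y with
  | nil => exact codes_nil _
  | cons w Y ih =>
    rw [List.map_cons, List.flatten_cons] at h
    have h1 := (codes_append.1 h).1
    obtain ⟨hw, d, hd, hdw⟩ := half_of_mem_roots (hY w (by simp)) hy hwin h1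
    have hd2 : D.Shift (w ++ w).length (2 * d) := by
      rw [List.length_append, two_mul]
      exact hd.add hd
    rw [codes_append_of_shift hd2] at h
    have := ih (fun v hv => hY v (by simp [hv])) (hy.add (D.F.mul_mem two_mem hd.mem)) hdw h.2
    rw [List.flatten_cons, codes_append_of_shift hd]
    refine ⟨hw, ?_⟩
    convert this using 1
    ring

end RotationData

end Sturmian

/-! ### Maximal solutions: shape and effect on the point -/

namespace Sturmian

namespace RotationData

variable {K : Type*} [Field K] [LinearOrder K] [IsStrictOrderedRing K] (D : RotationData K)

/-- The word `w` is a solution whose square is a prefix of the coding of `y`. -/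
def SolutionAt (w : BinWord) (y : K) : Prop :=
  w ≠ [] ∧ (∃ Y : List BinWord, (∀ v ∈ Y, v ∈ D.roots) ∧ Y.flatten = w ∧
    (Y.map fun v => v ++ v).flatten = w ++ w) ∧ D.Codes (w ++ w) y

/-- The word `w` is the maximal solution at the point `y`. -/
def MaxSolutionAt (w : BinWord) (y : K) : Prop :=
  D.SolutionAt w y ∧ ∀ v, D.SolutionAt v y → v.length ≤ w.length

variable {D}

/-- Two words of equal length read from the same point coincide. So the product of roots equals `w`,
read from `y / 2`, and the product of squares equals `w ++ w`, read from `y`. -/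
theorem Parses.solutionAt {y d : K} {w : BinWord} (h : D.Parses y w.length) (hw : w ≠ [])
    (hd : D.Shift w.length d) (h1 : D.Codes w y) (h2 : D.Codes w (y + d))
    (h3 : D.Codes w (y / 2)) : D.SolutionAt w y := by
  obtain ⟨Y, hY, hl, h4, h5⟩ := h
  have hww := (codes_append_of_shift hd).2 ⟨h1, h2⟩
  refine ⟨hw, ⟨Y, hY, h5.ext h3 hl, h4.ext hww ?_⟩, hww⟩
  rw [sum_length_squares, hl, List.length_append, two_mul]

theorem SolutionAt.codes_half {w : BinWord} {y : K} (h : D.SolutionAt w y) (hy : D.Generic y)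
    (hwin : D.InWindow y) : D.Codes w (y / 2) := by
  obtain ⟨-, ⟨Y, hY, rfl, hsq⟩, hc⟩ := h
  exact codes_half_of_squares hY hy hwin (hsq ▸ hc)

theorem SolutionAt.codes {w : BinWord} {y : K} (h : D.SolutionAt w y) : D.Codes w y :=
  (codes_append.1 h.2.2).1

theorem MaxSolutionAt.eq {w v : BinWord} {y : K} (h : D.MaxSolutionAt w y)
    (hv : D.SolutionAt v y) (hmax : w.length ≤ v.length) : w = v :=
  h.1.codes.ext hv.codes (le_antisymm hmax (h.2 v hv))

theorem inWindow_of_abs_lt {y : K} (h : |y| < D.t 0) : D.InWindow y := by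
  have := D.t_zero_le
  have := D.t_pos 0
  have := D.t_pos 1
  obtain ⟨h1, h2⟩ := abs_lt.1 h
  constructor <;> linarith

theorem inWindow_e_mul {k : ℕ} {z : K} (h0 : -D.t 0 < z) (h1 : z < D.t 0) :
    D.InWindow (e K k * z) :=
  inWindow_of_abs_lt (by rw [abs_e_mul]; exact abs_lt.2 ⟨h0, h1⟩)

/-- Points of the window on different sides of `0` have different letters. -/
theorem letter_ne_of_inWindow {k : ℕ} {z z' : K} (h : D.InWindow (e K k * z))
    (h' : D.InWindow (e K k * z')) (h0 : 0 < z) (h1 : z' < 0) :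
    D.letter (e K k * z) ≠ D.letter (e K k * z') := by
  rcases e_eq (K := K) k with hk | hk <;> rw [hk] at h h' ⊢
  · rw [D.letter_eq_one (by linarith) h.2, D.letter_eq_zero h'.1 (by linarith)]
    decide
  · rw [D.letter_eq_zero h.1 (by linarith), D.letter_eq_one (by linarith) h'.2]
    decide

theorem revStandard_ne_nil (k : ℕ) : D.S k ≠ [] := by
  intro h
  have : k < (D.S k).length := lt_length_revStandard D.a D.two_le_a_one D.one_le_a k
  simp [h] at this

theorem t_le_zero (k : ℕ) : D.t k ≤ D.t 0 := D.t_anti.antitone (Nat.zero_le k)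

theorem g_add_le {k l : ℕ} (hl : 1 ≤ l) : D.g k l + D.t (k + 1) ≤ D.t k := by
  have := D.g_anti k hl
  rw [g_succ, g_zero] at this
  linarith

section Semistandard

variable {k l : ℕ} {z : K}

theorem solutionAt_W (hl : 1 ≤ l) (hl' : l ≤ D.a (k + 2)) (hz : D.Generic z) (h0 : D.g k l < z)
    (h1 : z < D.g k l + D.t (k + 1)) : D.SolutionAt (D.W k l) (e K k * z) := by
  have hg := D.g_pos hl'
  have hh := D.t_pos (k + 1)
  have hs := D.codesStage (k := k) (Or.inr hl)
  refine (D.parses_W hl hl' hz h0 h1).solutionAt ?_ (D.shift_W k l)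
    (hs.left z hz (by linarith) h1) ?_ ?_
  · simp [revSemistandard, revStandard_ne_nil]
  · convert hs.left (z - D.g k l) (hz.sub (D.g_mem _ _)) (by linarith) (by linarith) using 1
    ring
  · convert hs.left (z / 2) hz.half (by linarith) (by linarith) using 1
    ring

theorem SolutionAt.length_le_W {v : BinWord} (hv : D.SolutionAt v (e K k * z)) (hl : 1 ≤ l)
    (hl' : l < D.a (k + 2)) (hz : D.Generic z) (h0 : D.g k l < z)
    (h1 : z < D.g k l + D.t (k + 1)) : v.length ≤ (D.W k l).length := by
  by_contra! hlen
  have hg := D.lt_g hl'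
  have h2 := D.t_pos (k + 2)
  have h3 := D.t_pos (k + 1)
  have h4 := t_le_zero (D := D) k
  have h5 := g_add_le (D := D) (k := k) hl
  have hwin : D.InWindow (e K k * z) := inWindow_e_mul (by linarith) (by linarith)
  -- Since `l < a (k + 2)`, `g k l` exceeds `t (k + 1)`, hence `z / 2 < g k l < z`: after `|W k l|`
  -- letters the orbits of `z` and `z / 2` are on opposite sides of `0`.
  have := hv.codes.letter_eq (hv.codes_half (hz.e_mul k) hwin) hlen (D.shift_W k l)
  rw [show e K k * z + -(e K k * D.g k l) = e K k * (z - D.g k l) by ring,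
    show e K k * z / 2 + -(e K k * D.g k l) = e K k * (z / 2 - D.g k l) by ring] at this
  exact letter_ne_of_inWindow (inWindow_e_mul (by linarith) (by linarith))
    (inWindow_e_mul (by linarith) (by linarith)) (by linarith) (by linarith) this

end Semistandard

variable (D) in
/-- On the interval `(0, B)` the word `S k` is a prefix of the coding. -/
structure StandardRange (k : ℕ) (B : K) : Prop where
  window : ∀ z, 0 < z → z < B → D.InWindow (e K k * z)
  codes : ∀ z, D.Generic z → 0 < z → z < B → D.Codes (D.S k) (e K k * z)
  parses : ∀ z, D.Generic z → D.t k < z → z < B → D.Parses (e K k * z) (D.S k).length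
  lt : B < (D.a (k + 1) + 2) * D.t k

theorem standardRange_zero : D.StandardRange 0 (1 - D.t 0) := by
  have h0 := D.t_zero_le
  have h1 := D.t_pos 1
  have h2 := D.t_lt 0
  have h3 := D.t_one
  rw [zero_add] at h2
  refine ⟨fun z hz hz1 => ?_, fun z _ hz hz1 => ?_, fun z _ hz hz1 => ?_, by
    rw [zero_add]; linarith⟩ <;> rw [e_zero]
  · constructor <;> linarith
  · exact D.codes_S_zero (by linarith) (by linarith)
  · exact D.parses_S_zero (by linarith) (by linarith)

theorem standardRange_one : D.StandardRange 1 (D.t 0) := by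
  have h1 := D.t_pos 1
  have h2 := D.t_lt 1
  have h3 := D.t_rec 0
  simp only [zero_add, Nat.reduceAdd] at *
  refine ⟨fun z hz hz1 => inWindow_e_mul (by linarith) (by linarith), fun z _ hz hz1 => ?_,
    fun z _ hz hz1 => ?_, by simp only [Nat.reduceAdd]; linarith⟩ <;> rw [e_one]
  · exact D.codes_S_one (by linarith) (by linarith)
  · exact D.parses_S_one (by linarith) (by linarith)

theorem standardRange_add_two (k : ℕ) : D.StandardRange (k + 2) (D.t (k + 2) + D.t (k + 1)) := by
  have h1 := D.g_self k
  have h2 := D.t_add_le k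
  have h3 := t_le_zero (D := D) k
  have h4 := D.t_rec (k + 1)
  have h5 := D.t_lt (k + 2)
  have h6 := D.t_pos (k + 2)
  have he : e K (k + 2) = e K k := by rw [e_succ, e_succ, neg_neg]
  refine ⟨fun z hz hz1 => inWindow_e_mul (by linarith) (by linarith), fun z hz hz0 hz1 => ?_,
    fun z hz hz0 hz1 => ?_, ?_⟩
  · rw [he, S, ← revSemistandard_self]
    exact (D.codesStage (Or.inr (D.one_le_a k))).left z hz hz0 (by rw [h1]; exact hz1)
  · rw [he, S, ← revSemistandard_self]
    exact D.parses_W (D.one_le_a k) le_rfl hz (by rw [h1]; exact hz0) (by rw [h1]; exact hz1)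
  · simp only [add_assoc, Nat.reduceAdd] at *
    linarith

theorem exists_standardRange (k : ℕ) {z : K} (h : z < D.t k) :
    ∃ B, D.StandardRange (k + 1) B ∧ z < B := by
  rcases k with _ | k
  · exact ⟨_, standardRange_one, h⟩
  · exact ⟨_, standardRange_add_two k, by have := D.t_pos (k + 2); linarith⟩

/-- A primitive word does not occur in its square at an interior position, since it would equal a
proper conjugate and its two parts would commute. -/
theorem eq_zero_of_codes_conjugate {u : BinWord} (hu : u.IsPrimitive) {y : K} {r : ℕ}
    (h : D.Codes (u ++ u) y) (h' : D.Codes u (y + r * D.t 0)) (hr : r < u.length) : r = 0 := by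
  obtain ⟨x, v, rfl, rfl⟩ : ∃ x v : BinWord, u = x ++ v ∧ r = x.length :=
    ⟨u.take r, u.drop r, (List.take_append_drop r u).symm, by simp; omega⟩
  have h2 : D.Codes (v ++ x) (y + x.length * D.t 0) := by
    rw [List.append_assoc, codes_append, ← List.append_assoc v, codes_append] at h
    exact h.2.1
  have h3 := h'.ext h2 (by simp [add_comm])
  rcases hu.eq_nil_or_eq_nil_of_append_comm h3 with rfl | rfl
  · rfl
  · simp at hr

theorem Codes.transfer {u v : BinWord} {y y' : K} (hu : D.Codes u y) (hv : D.Codes v y)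
    (hv' : D.Codes v y') (h : u.length ≤ v.length) : D.Codes u y' := fun i hi => by
  rw [hu i hi, ← hv i (by omega), hv' i (by omega)]

namespace StandardRange

variable {k n : ℕ} {B z : K}

theorem codes_pow (h : D.StandardRange k B) (hz : D.Generic z) (h0 : 0 < z)
    (h1 : n * D.t k < z) (h2 : z < B) : D.Codes ((D.S k).pow (n + 1)) (e K k * z) := by
  induction n generalizing z with
  | zero =>
    rw [zero_add, BinWord.pow_one']
    exact h.codes z hz h0 h2
  | succ n ih =>
    have ht := D.t_pos k
    have hn : 0 ≤ (n : K) * D.t k := mul_nonneg (Nat.cast_nonneg _) ht.le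
    push_cast at h1
    rw [BinWord.pow_succ', codes_append_of_shift (D.shift_S k)]
    refine ⟨h.codes z hz h0 h2, ?_⟩
    convert ih (z := z - D.t k) (hz.sub (D.t_mem k)) (by linarith) (by linarith)
      (by linarith) using 1
    ring

theorem parses_pow (h : D.StandardRange k B) (hz : D.Generic z)
    (h1 : (2 * n + 1) * D.t k < z) (h2 : z < B) :
    D.Parses (e K k * z) ((D.S k).pow (n + 1)).length := by
  induction n generalizing z with
  | zero =>
    rw [zero_add, BinWord.pow_one']
    exact h.parses z hz (by simpa using h1) h2
  | succ n ih =>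
    have ht := D.t_pos k
    have hn : 0 ≤ (n : K) * D.t k := mul_nonneg (Nat.cast_nonneg _) ht.le
    push_cast at h1
    rw [BinWord.pow_succ', List.length_append]
    refine (h.parses z hz (by linarith) h2).trans (D.shift_S k) ?_
    convert ih (z := z - 2 * D.t k) (hz.sub (D.F.mul_mem two_mem (D.t_mem k))) (by linarith)
      (by linarith) using 1
    ring

theorem shift_pow (k n : ℕ) :
    D.Shift ((D.S k).pow (n + 1)).length (-(e K k * ((n + 1) * D.t k))) := by
  rw [BinWord.length_pow]
  convert (D.shift_S k).mul (n + 1) using 1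
  push_cast
  ring

theorem solutionAt_pow (h : D.StandardRange k B) (hz : D.Generic z)
    (h1 : (2 * n + 1) * D.t k < z) (h2 : z < B) :
    D.SolutionAt ((D.S k).pow (n + 1)) (e K k * z) := by
  have ht := D.t_pos k
  have hn : 0 ≤ (n : K) * D.t k := mul_nonneg (Nat.cast_nonneg _) ht.le
  have hF : (n + 1) * D.t k ∈ D.F :=
    D.F.mul_mem (D.F.add_mem (natCast_mem _ _) D.F.one_mem) (D.t_mem k)
  refine (h.parses_pow hz h1 h2).solutionAt ?_ (shift_pow k n)
    (h.codes_pow hz (by linarith) (by linarith) h2) ?_ ?_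
  · simp [BinWord.pow_succ', revStandard_ne_nil]
  · convert h.codes_pow (n := n) (hz.sub hF) (by linarith) (by linarith) (by linarith) using 1
    ring
  · convert h.codes_pow (n := n) hz.half (by linarith) (by linarith) (by linarith) using 1
    ring

/-- A longer solution forces `2 * (n + 1) * t k < z`, by comparing `z` and `z / 2`. The same
comparison one power later bounds it by the length of `S k ^ (n + 2)`. Equality is excluded by the
second copy of `v`, which would cross `0` too early, and a length strictly in between by the
primitivity of `S k`. -/
theorem length_le (h : D.StandardRange k B) {v : BinWord} (hv : D.SolutionAt v (e K k * z))
    (hz : D.Generic z) (h1 : (2 * n + 1) * D.t k < z) (h2 : z < (2 * n + 3) * D.t k)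
    (h3 : z < B) : v.length ≤ ((D.S k).pow (n + 1)).length := by
  by_contra! hlen
  have ht := D.t_pos k
  have ht0 := t_le_zero (D := D) k
  have hn : 0 ≤ (n : K) * D.t k := mul_nonneg (Nat.cast_nonneg _) ht.le
  have hF : (n + 1) * D.t k ∈ D.F :=
    D.F.mul_mem (D.F.add_mem (natCast_mem _ _) D.F.one_mem) (D.t_mem k)
  have hwin := h.window z (by linarith) h3
  have hhalf := hv.codes_half (hz.e_mul k) hwin
  have hc := (codes_append.1 hv.2.2).2
  have e1 := hv.codes.letter_eq hhalf hlen (shift_pow k n)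
  rw [show e K k * z + -(e K k * ((n + 1) * D.t k)) = e K k * (z - (n + 1) * D.t k) by ring,
    show e K k * z / 2 + -(e K k * ((n + 1) * D.t k)) = e K k * (z / 2 - (n + 1) * D.t k)
      by ring] at e1
  have h4 : 0 < z / 2 - (n + 1) * D.t k := by
    refine ((hz.half.sub hF).lt_or_gt D.F.zero_mem).resolve_left fun hneg => ?_
    exact letter_ne_of_inWindow (h.window _ (by linarith) (by linarith))
      (inWindow_e_mul (by linarith) (by linarith)) (by linarith) hneg e1
  have hs := shift_pow (D := D) k (n + 1)
  push_cast at hs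
  have hlen2 : v.length ≤ ((D.S k).pow (n + 1 + 1)).length := by
    by_contra! hlen2
    have e2 := hv.codes.letter_eq hhalf hlen2 hs
    rw [show e K k * z + -(e K k * ((n + 1 + 1) * D.t k)) =
        e K k * (z - (n + 1 + 1) * D.t k) by ring,
      show e K k * z / 2 + -(e K k * ((n + 1 + 1) * D.t k)) =
        e K k * (z / 2 - (n + 1 + 1) * D.t k) by ring] at e2
    exact letter_ne_of_inWindow (h.window _ (by linarith) (by linarith))
      (inWindow_e_mul (by linarith) (by linarith)) (by linarith) (by linarith) e2
  rcases hlen2.eq_or_lt with heq | hlt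
  · rw [heq, codes_shift hs] at hc
    have e2 := hv.codes.letter_eq hc hlen (shift_pow k n)
    rw [show e K k * z + -(e K k * ((n + 1) * D.t k)) = e K k * (z - (n + 1) * D.t k) by ring,
      show e K k * z + -(e K k * ((n + 1 + 1) * D.t k)) + -(e K k * ((n + 1) * D.t k)) =
        e K k * (z - (2 * n + 3) * D.t k) by ring] at e2
    exact letter_ne_of_inWindow (h.window _ (by linarith) (by linarith))
      (inWindow_e_mul (by linarith) (by linarith)) (by linarith) (by linarith) e2
  · obtain ⟨r, hr⟩ := Nat.exists_eq_add_of_lt hlen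
    rw [BinWord.pow_succ', List.length_append] at hlt
    have hU : D.Codes (D.S k) (e K k * z + v.length * D.t 0) :=
      (h.codes z hz (by linarith) h3).transfer hv.codes hc (by
        rw [hr, BinWord.length_pow, add_mul, one_mul]; omega)
    rw [hr, add_assoc] at hU
    have hU' : D.Codes (D.S k) (e K k * (z - (n + 1) * D.t k) + (r + 1 : ℕ) * D.t 0) := by
      rw [Nat.cast_add, add_mul, add_comm (Nat.cast _ * _), ← add_assoc,
        codes_shift (shift_pow k n)] at hU
      convert hU using 1
      ring
    have hUU := h.codes_pow (n := 1) (hz.sub hF) (by linarith) (by push_cast; linarith)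
      (by linarith)
    rw [BinWord.pow_succ', BinWord.pow_one'] at hUU
    have := eq_zero_of_codes_conjugate (isPrimitive_revStandard D.a k) hUU hU'
      (show r + 1 < (D.S k).length by omega)
    omega

theorem exists_nat (h : D.StandardRange k B) (hz : D.Generic z) (h1 : D.t k < z) (h2 : z < B) :
    ∃ n : ℕ, (2 * n + 1) * D.t k < z ∧ z < (2 * n + 3) * D.t k ∧ n + 1 ≤ D.a (k + 1) := by
  have ht := D.t_pos k
  have hB := h.lt
  have ha : 1 ≤ D.a (k + 1) := by
    rcases k with _ | k
    · have := D.two_le_a_one; rw [zero_add]; omega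
    · exact D.one_le_a k
  have hex : ∃ n : ℕ, z < (2 * n + 3) * D.t k := by
    refine ⟨D.a (k + 1), ?_⟩
    have : (0 : K) ≤ D.a (k + 1) * D.t k := by positivity
    linarith
  classical
  have hlow : (2 * (Nat.find hex : K) + 1) * D.t k < z := by
    rcases hn : Nat.find hex with _ | m
    · simpa using h1
    · have := Nat.find_min hex (m := m) (by omega)
      have hF : (2 * m + 3) * D.t k ∈ D.F := D.F.mul_mem (D.F.add_mem
        (D.F.mul_mem two_mem (natCast_mem _ _)) (ofNat_mem _ _)) (D.t_mem k)
      push_cast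
      rcases hz.lt_or_gt hF with h' | h'
      · exact absurd h' this
      · linarith
  -- The bound `B < (a (k + 1) + 2) * t k` gives `2 * n ≤ a (k + 1)`, and with `1 ≤ a (k + 1)` this
  -- yields `n + 1 ≤ a (k + 1)`.
  refine ⟨Nat.find hex, hlow, Nat.find_spec hex, ?_⟩
  have h3 : (2 * (Nat.find hex : K) + 1) < D.a (k + 1) + 2 :=
    lt_of_mul_lt_mul_right (hlow.trans (h2.trans hB)) ht.le
  have h4 : 2 * Nat.find hex + 1 < D.a (k + 1) + 2 := by exact_mod_cast h3
  omega

end StandardRange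

theorem a_mul_length_le (k : ℕ) : D.a (k + 1) * (D.S k).length ≤ (D.S (k + 1)).length := by
  rcases k with _ | k
  · rw [S, S, zero_add, length_revStandard_one _ D.two_le_a_one]
    simp [revStandard]
  · rw [S, S, length_revStandard_add_two]
    exact Nat.le_add_left _ _

theorem MaxSolutionAt.standard {w : BinWord} {k : ℕ} {B z : K}
    (hw : D.MaxSolutionAt w (e K k * z)) (h : D.StandardRange k B) (hz : D.Generic z)
    (h1 : D.t k < z) (h2 : z < B) :
    (∃ n, w = (D.S k).pow (n + 1)) ∧ w.length ≤ (D.S (k + 1)).length ∧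
      (D.S k).length ≤ w.length ∧ ∃ d, D.Shift w.length d ∧ |e K k * z + 2 * d| < D.t k := by
  obtain ⟨n, hn1, hn2, hn3⟩ := h.exists_nat hz h1 h2
  obtain rfl := hw.eq (h.solutionAt_pow hz hn1 h2) (h.length_le hw.1 hz hn1 hn2 h2)
  refine ⟨⟨n, rfl⟩, ?_, ?_, _, StandardRange.shift_pow k n, ?_⟩
  · rw [BinWord.length_pow]
    exact (Nat.mul_le_mul_right _ hn3).trans (a_mul_length_le k)
  · rw [BinWord.length_pow]
    exact Nat.le_mul_of_pos_left _ n.succ_pos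
  · rw [show e K k * z + 2 * -(e K k * ((n + 1) * D.t k)) =
      e K k * (z - 2 * ((n + 1) * D.t k)) by ring, abs_e_mul, abs_lt]
    constructor <;> linarith

theorem MaxSolutionAt.semistandard {w : BinWord} {k l : ℕ} {z : K}
    (hw : D.MaxSolutionAt w (e K k * z)) (hl : 1 ≤ l) (hl' : l < D.a (k + 2)) (hz : D.Generic z)
    (h0 : D.g k l < z) (h1 : z < D.g k l + D.t (k + 1)) : w = D.W k l :=
  hw.eq (solutionAt_W hl hl'.le hz h0 h1) (hw.1.length_le_W hl hl' hz h0 h1)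

theorem solutionAt_swapped (k : ℕ) {z : K} (hz : D.Generic z) (h0 : 0 < z)
    (h1 : z < D.t (k + 2) - D.t (k + 3)) : D.SolutionAt (D.swapped (k + 1)) (e K (k + 2) * z) := by
  have ht := D.t_pos (k + 3)
  have hp := D.parses_swapped k hz h0 h1
  have hc : ∀ x, D.Generic x → 0 < x → x < D.t (k + 2) →
      D.Codes (D.swapped (k + 1)) (e K (k + 2) * x) := fun x hx => D.codes_swapped (k + 1) hx
  have hs := D.shift_S_succ (k + 2)
  rw [← length_swapped (k := k + 1)] at hp hs
  refine hp.solutionAt (by simp [revStandard_ne_nil]) hs (hc z hz h0 (by linarith)) ?_ ?_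
  · rw [← mul_add]
    exact hc _ (hz.add (D.t_mem _)) (by linarith) (by linarith)
  · rw [mul_div_assoc]
    exact hc _ hz.half (by linarith) (by linarith)

/-- A point with a maximal solution is not too close to the discontinuity. -/
theorem MaxSolutionAt.exists_t_lt {w : BinWord} {y : K} (hw : D.MaxSolutionAt w y)
    (hy : D.Generic y) : ∃ k z, y = e K k * z ∧ D.t k < z := by
  -- The parity of `k` is chosen to match the side of `y`. If `y` were within `t (k + 4)`, then
  -- `swapped (k + 1)` would be a solution longer than `w`. This is where maximality excludes
  -- infinitesimal points.
  obtain ⟨k, hk, hpos⟩ : ∃ k, w.length ≤ k ∧ 0 < e K (k + 2) * y := by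
    rcases (hy.e_mul (w.length + 2)).lt_or_gt D.F.zero_mem with h | h
    · exact ⟨w.length + 1, by omega, by
        rw [show w.length + 1 + 2 = w.length + 2 + 1 by ring, e_succ]; linarith⟩
    · exact ⟨w.length, le_rfl, h⟩
  have hgen := hy.e_mul (k + 2)
  refine ⟨k + 4, e K (k + 4) * y, (e_mul_mul _ _).symm, ?_⟩
  have he : e K (k + 4) = e K (k + 2) := by
    rw [show k + 4 = k + 2 + 1 + 1 by ring, e_succ, e_succ, neg_neg]
  rw [he]
  refine (hgen.lt_or_gt (D.t_mem (k + 4))).resolve_left fun hlt => ?_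
  have hsol := solutionAt_swapped k hgen hpos (by have := D.t_add_le (k + 2); linarith)
  rw [e_mul_mul] at hsol
  have h1 := hw.2 _ hsol
  rw [length_swapped] at h1
  have h2 : k + 3 < (D.S (k + 1 + 2)).length :=
    lt_length_revStandard D.a D.two_le_a_one D.one_le_a (k + 3)
  omega

theorem exists_interval {y : K} (hy : D.Generic y) (hwin : D.InWindow y) {k : ℕ} {z : K}
    (hyz : y = e K k * z) (hz : D.t k < z) :
    (∃ k z B, y = e K k * z ∧ D.StandardRange k B ∧ D.t k < z ∧ z < B) ∨
    ∃ k l z, y = e K k * z ∧ 1 ≤ l ∧ l < D.a (k + 2) ∧ D.g k l < z ∧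
      z < D.g k l + D.t (k + 1) := by
  induction k using Nat.twoStepInduction with
  | zero =>
    refine Or.inl ⟨0, z, _, hyz, standardRange_zero, hz, ?_⟩
    have := hwin.1
    rw [hyz, e_zero] at this
    linarith
  | one =>
    refine Or.inl ⟨1, z, _, hyz, standardRange_one, hz, ?_⟩
    have := hwin.2
    rw [hyz, e_one] at this
    linarith
  | more k ih _ =>
    have he : e K (k + 2) = e K k := by rw [e_succ, e_succ, neg_neg]
    have hyz' : y = e K k * z := by rw [hyz, he]
    have hzg : D.Generic z := by
      have := hy.e_mul k
      rwa [hyz', e_mul_mul] at this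
    rcases hzg.lt_or_gt (D.t_mem k) with h | h
    -- The numbers `g k l` cut the range from `t (k + 2)` to `t k` into pieces of length `t (k +
    -- 1)`; the least `l` names the piece containing `z`. The lowest piece, `l = a (k + 2)`, belongs
    -- to the standard word `S (k + 2)`.
    · have hex : ∃ l, D.g k l < z := ⟨_, by rw [g_self]; exact hz⟩
      classical
      have hle : Nat.find hex ≤ D.a (k + 2) := Nat.find_min' hex (by rw [g_self]; exact hz)
      have hspec := Nat.find_spec hex
      obtain ⟨m, hm⟩ : ∃ m, Nat.find hex = m + 1 := by
        refine Nat.exists_eq_succ_of_ne_zero fun h0 => ?_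
        rw [h0, g_zero] at hspec
        exact absurd h (not_lt.2 hspec.le)
      have hup : z < D.g k (m + 1) + D.t (k + 1) := by
        rw [g_succ, sub_add_cancel]
        exact (hzg.lt_or_gt (D.g_mem k m)).resolve_right
          (Nat.find_min hex (m := m) (by omega))
      rw [hm] at hle hspec
      rcases hle.eq_or_lt with heq | hlt
      · refine Or.inl ⟨k + 2, z, _, hyz, standardRange_add_two k, hz, ?_⟩
        rw [heq, g_self] at hup
        exact hup
      · exact Or.inr ⟨k, m + 1, z, hyz', by omega, hlt, hspec, hup⟩
    · exact ih hyz' h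

/-- The shape of the maximal solution at `y`, and the next point. -/
theorem MaxSolutionAt.step {w : BinWord} {y : K} (hw : D.MaxSolutionAt w y) (hy : D.Generic y)
    (hwin : D.InWindow y) : ∃ d, D.Shift w.length d ∧ |y + 2 * d| < D.t 0 ∧
      |y + 2 * d| < |y| ∧ (∀ k, |y| < D.t k → (D.S (k + 1)).length ≤ w.length) ∧
      ((∃ k, D.t k < |y| ∧ |y + 2 * d| < D.t k ∧ w.length ≤ (D.S (k + 1)).length) ∨
        ∃ k l, 1 ≤ l ∧ l < D.a (k + 2) ∧ w = D.W k l ∧ D.t (k + 1) < |y| ∧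
          0 < e K (k + 1) * (y + 2 * d) ∧ |y + 2 * d| < D.t k) := by
  obtain ⟨k, z, hyz, hz⟩ := hw.exists_t_lt hy
  have hmono := length_revStandard_mono D.a D.two_le_a_one D.one_le_a
  rcases exists_interval hy hwin hyz hz with ⟨k, z, B, rfl, hB, h1, h2⟩ |
    ⟨k, l, z, rfl, hl, hl', h1, h2⟩
  · have hzg : D.Generic z := by simpa only [e_mul_mul] using hy.e_mul k
    obtain ⟨-, h4, h5, d, hd, h6⟩ := hw.standard hB hzg h1 h2
    have hk : D.t k < |e K k * z| := by rw [abs_e_mul]; exact h1.trans_le (le_abs_self z)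
    refine ⟨d, hd, h6.trans_le (t_le_zero k), h6.trans hk, fun j hj => ?_,
      Or.inl ⟨k, hk, h6, h4⟩⟩
    have : j < k := D.t_anti.lt_iff_gt.1 (hk.trans hj)
    exact (hmono.monotone (Nat.succ_le_of_lt this)).trans h5
  · have hzg : D.Generic z := by simpa only [e_mul_mul] using hy.e_mul k
    have hwW := hw.semistandard hl hl' hzg h1 h2
    have hg := D.lt_g hl'
    have h3 := D.t_pos (k + 2)
    have h4 := D.t_pos (k + 1)
    have h5 := g_add_le (D := D) (k := k) hl
    have h6 := t_le_zero (D := D) k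
    have hz0 : |e K k * z| = z := by rw [abs_e_mul, abs_of_pos (by linarith)]
    have heq : e K k * z + 2 * -(e K k * D.g k l) = e K k * (z - 2 * D.g k l) := by ring
    have hneg : z - 2 * D.g k l < 0 := by linarith
    have habs : |e K k * (z - 2 * D.g k l)| = 2 * D.g k l - z := by
      rw [abs_e_mul, abs_of_neg hneg, neg_sub]
    refine ⟨_, hwW ▸ D.shift_W k l, ?_, ?_, fun j hj => ?_,
      Or.inr ⟨k, l, hl, hl', hwW, ?_, ?_, ?_⟩⟩
    · rw [heq, habs]; linarith
    · rw [heq, habs, hz0]; linarith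
    · rw [hz0] at hj
      have hjk : j < k + 1 := D.t_anti.lt_iff_gt.1 (by linarith)
      refine (hmono.monotone (show j + 1 ≤ k + 1 by omega)).trans ?_
      rw [hwW, length_revSemistandard]
      nlinarith
    · rw [hz0]; linarith
    · rw [heq, e_succ, neg_mul, e_mul_mul]; linarith
    · rw [heq, habs]; linarith

/-! ### The orbit of the factorization -/

section Factorization

variable {X : ℕ → BinWord} {y₀ : K}

variable (D) in
/-- The point `y` represents the position of the `i`-th factor in the coding of `y₀`. -/
def OrbitAt (X : ℕ → BinWord) (y₀ : K) (i : ℕ) (y : K) : Prop :=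
  ∃ m : ℤ, y = y₀ + (∑ j ∈ Finset.range i, 2 * (X j).length : ℕ) * D.t 0 - m

theorem OrbitAt.succ {i : ℕ} {y d : K} (h : D.OrbitAt X y₀ i y)
    (hd : D.Shift (X i).length d) : D.OrbitAt X y₀ (i + 1) (y + 2 * d) := by
  obtain ⟨m, rfl⟩ := h
  obtain ⟨n, rfl⟩ := hd
  refine ⟨m + 2 * n, ?_⟩
  rw [Finset.sum_range_succ]
  push_cast
  ring

theorem OrbitAt.generic {i : ℕ} {y : K} (h : D.OrbitAt X y₀ i y) (hy : D.Generic y₀) :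
    D.Generic y := by
  obtain ⟨m, rfl⟩ := h
  exact (hy.add (D.F.mul_mem (natCast_mem _ _) (D.t_mem 0))).sub (intCast_mem _ _)

theorem codes_sub_intCast {w : BinWord} {y : K} {m : ℤ} :
    D.Codes w (y - m) ↔ D.Codes w y := by
  have hs : D.Shift 0 (-m : K) := ⟨m, by simp⟩
  rw [sub_eq_add_neg, ← codes_shift hs]
  simp

theorem maxSolutionAt_sub_intCast {w : BinWord} {y : K} {m : ℤ} :
    D.MaxSolutionAt w (y - m) ↔ D.MaxSolutionAt w y := by
  simp only [MaxSolutionAt, SolutionAt, codes_sub_intCast]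

variable (hX : ∀ i, D.MaxSolutionAt (X i)
  (y₀ + (∑ j ∈ Finset.range i, 2 * (X j).length : ℕ) * D.t 0))

include hX in
theorem OrbitAt.maxSolutionAt {i : ℕ} {y : K} (h : D.OrbitAt X y₀ i y) :
    D.MaxSolutionAt (X i) y := by
  obtain ⟨m, rfl⟩ := h
  exact maxSolutionAt_sub_intCast.2 (hX i)

include hX in
theorem OrbitAt.length_le {i k : ℕ} {y : K} (h : D.OrbitAt X y₀ i y) (hy : D.Generic y₀)
    (hk : |y| < D.t k) : (D.S (k + 1)).length ≤ (X i).length := by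
  obtain ⟨d, -, -, -, h1, -⟩ := (h.maxSolutionAt hX).step (h.generic hy)
    (inWindow_of_abs_lt (hk.trans_le (t_le_zero k)))
  exact h1 k hk

include hX in
/-- After a point between `t (k + 1)` and `t k` on the side of the words `S (k + 1)`, the orbit
comes closer than `t (k + 1)`. -/
theorem OrbitAt.standard {i k : ℕ} {y : K} (h : D.OrbitAt X y₀ i y) (hy : D.Generic y₀)
    (h0 : 0 < e K (k + 1) * y) (h1 : D.t (k + 1) < |y|) (h2 : |y| < D.t k) :
    (∃ n, X i = (D.S (k + 1)).pow (n + 1)) ∧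
      ∃ y', D.OrbitAt X y₀ (i + 1) y' ∧ |y'| < D.t (k + 1) := by
  have habs : e K (k + 1) * y = |y| := by rw [← abs_e_mul (k + 1) y, abs_of_pos h0]
  have hyz : y = e K (k + 1) * |y| := by rw [← habs, e_mul_mul]
  have hz : D.Generic |y| := habs ▸ (h.generic hy).e_mul (k + 1)
  obtain ⟨B, hB, hlt⟩ := exists_standardRange k h2
  have hw := h.maxSolutionAt hX
  rw [hyz] at hw
  obtain ⟨h3, -, -, d, hd, h4⟩ := hw.standard hB hz h1 hlt
  rw [← hyz] at h4
  exact ⟨h3, _, h.succ hd, h4⟩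

include hX in
-- A standard step cannot precede a drop, because it leaves the point within `t k` while `X i` is at
-- most as long as `S (k + 1)`. After a semistandard step the point must remain beyond `t (k + 1)`,
-- as otherwise `X (i + 1)` would be at least as long as `S (k + 2)`.
theorem OrbitAt.of_length_lt {i : ℕ} {y : K} (h : D.OrbitAt X y₀ i y) (hy : D.Generic y₀)
    (hwin : D.InWindow y) (hlen : (X (i + 1)).length < (X i).length) :
    ∃ k l n, 1 ≤ l ∧ l < D.a (k + 2) ∧ X i = D.W k l ∧ X (i + 1) = (D.S (k + 1)).pow (n + 1) ∧
      (X i).length < (X (i + 2)).length := by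
  obtain ⟨d, hd, -, -, -, ⟨k, -, h1, h2⟩ | ⟨k, l, hl, hl', h1, -, h2, h3⟩⟩ :=
    (h.maxSolutionAt hX).step (h.generic hy) hwin
  · have := (h.succ hd).length_le hX hy h1
    omega
  · have hW : (X i).length < (D.S (k + 2)).length := by
      rw [h1, length_revSemistandard, length_revStandard_add_two]
      have := lt_length_revStandard D.a D.two_le_a_one D.one_le_a (k + 1)
      exact Nat.add_lt_add_left (Nat.mul_lt_mul_of_pos_right hl' (by omega)) _
    have hle : D.t (k + 1) < |y + 2 * d| := by
      by_contra! hle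
      rcases hle.lt_or_eq with hlt | heq
      · have : (D.S (k + 2)).length ≤ _ := (h.succ hd).length_le hX hy hlt
        omega
      · have hgen := ((h.succ hd).generic hy).e_mul (k + 1)
        rw [← abs_of_pos h2, abs_e_mul, heq] at hgen
        exact hgen (D.t_mem _)
    obtain ⟨⟨n, hn⟩, y', hy', hlt⟩ := (h.succ hd).standard hX hy h2 hle h3
    exact ⟨k, l, n, hl, hl', h1, hn, hW.trans_le (hy'.length_le hX hy hlt)⟩

include hX in
-- One step suffices unless it is semistandard and lands beyond `t (j + 1)`; it then lies on the
-- side where a standard step follows. In the other cases the second step only decreases the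
-- distance to `0`.
theorem OrbitAt.two_steps {i k : ℕ} {y : K} (h : D.OrbitAt X y₀ i y) (hy : D.Generic y₀)
    (hk : |y| < D.t k) : ∃ y', D.OrbitAt X y₀ (i + 2) y' ∧ |y'| < D.t (k + 1) := by
  obtain ⟨d, hd, h1, -, -, h2⟩ := (h.maxSolutionAt hX).step (h.generic hy)
    (inWindow_of_abs_lt (hk.trans_le (t_le_zero k)))
  have hs := h.succ hd
  obtain ⟨d', hd', -, h3, -⟩ := (hs.maxSolutionAt hX).step (hs.generic hy)
    (inWindow_of_abs_lt h1)
  have close : |y + 2 * d| < D.t (k + 1) →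
      ∃ y', D.OrbitAt X y₀ (i + 2) y' ∧ |y'| < D.t (k + 1) :=
    fun h4 => ⟨_, hs.succ hd', h3.trans h4⟩
  rcases h2 with ⟨j, h4, h5, -⟩ | ⟨j, l, -, -, -, h4, h5, h6⟩
  · have : k < j := D.t_anti.lt_iff_gt.1 (h4.trans hk)
    exact close (h5.trans_le (D.t_anti.antitone this))
  · have hkj : k < j + 1 := D.t_anti.lt_iff_gt.1 (h4.trans hk)
    have hle : D.t (j + 1) ≤ D.t (k + 1) := D.t_anti.antitone hkj
    rcases lt_or_ge (D.t (j + 1)) |y + 2 * d| with h7 | h7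
    · obtain ⟨-, y', hy', hlt⟩ := hs.standard hX hy h5 h7 h6
      exact ⟨y', hy', hlt.trans_le hle⟩
    · exact ⟨_, hs.succ hd', (h3.trans_le h7).trans_le hle⟩

include hX in
theorem OrbitAt.eventually_abs_lt {y : K} (h : D.OrbitAt X y₀ 0 y) (hy : D.Generic y₀)
    (hwin : D.InWindow y) (k : ℕ) :
    ∃ N, ∀ i, N ≤ i → ∃ y', D.OrbitAt X y₀ i y' ∧ |y'| < D.t k := by
  induction k with
  | zero =>
    refine ⟨1, fun i hi => ?_⟩
    induction i, hi using Nat.le_induction with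
    | base =>
      obtain ⟨d, hd, h1, -⟩ := (h.maxSolutionAt hX).step (h.generic hy) hwin
      exact ⟨_, h.succ hd, h1⟩
    | succ i _ ih =>
      obtain ⟨y', hy', hlt⟩ := ih
      obtain ⟨d, hd, h1, -⟩ := (hy'.maxSolutionAt hX).step (hy'.generic hy)
        (inWindow_of_abs_lt hlt)
      exact ⟨_, hy'.succ hd, h1⟩
  | succ k ih =>
    obtain ⟨N, hN⟩ := ih
    refine ⟨N + 2, fun i hi => ?_⟩
    obtain ⟨j, rfl⟩ := Nat.exists_eq_add_of_le' (by omega : 2 ≤ i)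
    obtain ⟨y', hy', hlt⟩ := hN j (by omega)
    exact hy'.two_steps hX hy hlt

include hX in
theorem OrbitAt.eventually_le_length {y : K} (h : D.OrbitAt X y₀ 0 y) (hy : D.Generic y₀)
    (hwin : D.InWindow y) (k : ℕ) : ∃ N, ∀ i, N ≤ i → k < (X i).length := by
  obtain ⟨N, hN⟩ := h.eventually_abs_lt hX hy hwin k
  refine ⟨N, fun i hi => ?_⟩
  obtain ⟨y', hy', hlt⟩ := hN i hi
  have h1 := hy'.length_le hX hy hlt
  have h2 : k + 1 < (D.S (k + 1)).length :=
    lt_length_revStandard D.a D.two_le_a_one D.one_le_a (k + 1)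
  omega

end Factorization

end RotationData

end Sturmian

/-! ### Continued fractions: the distances `t k` as products of Gauss map iterates -/

namespace Sturmian

section ContinuedFraction

/-- The fractional parts in the continued fraction algorithm. -/
noncomputable def gaussOrbit (α : ℝ) : ℕ → ℝ
  | 0 => α
  | k + 1 => Int.fract (gaussOrbit α k)⁻¹

/-- The product of the first `k + 1` fractional parts. -/
noncomputable def gaussProd (α : ℝ) (k : ℕ) : ℝ :=
  ∏ i ∈ Finset.range (k + 1), gaussOrbit α i

variable {α : ℝ} (hα : Irrational α) (hα0 : 0 < α) (hα1 : α < 1)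

include hα in
theorem irrational_gaussOrbit (k : ℕ) : Irrational (gaussOrbit α k) := by
  induction k with
  | zero => exact hα
  | succ k ih => exact ih.inv.sub_intCast _

include hα hα0 hα1 in
theorem gaussOrbit_mem (k : ℕ) : 0 < gaussOrbit α k ∧ gaussOrbit α k < 1 := by
  rcases k with _ | k
  · exact ⟨hα0, hα1⟩
  · exact ⟨(Int.fract_nonneg _).lt_of_ne (irrational_gaussOrbit hα (k + 1)).ne_zero.symm,
      Int.fract_lt_one _⟩

include hα hα0 hα1 in
theorem exists_stream_eq (k : ℕ) : ∃ b, GenContFract.IntFractPair.stream α k =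
    some ⟨b, gaussOrbit α k⟩ := by
  induction k with
  | zero =>
    refine ⟨⌊α⌋, ?_⟩
    rw [GenContFract.IntFractPair.stream_zero, GenContFract.IntFractPair.of, gaussOrbit,
      Int.fract_eq_self.2 ⟨hα0.le, hα1⟩]
  | succ k ih =>
    obtain ⟨b, hb⟩ := ih
    exact ⟨_, GenContFract.IntFractPair.stream_succ_of_some hb
      (irrational_gaussOrbit hα k).ne_zero⟩

include hα hα0 hα1 in
theorem partialQuotient_succ (k : ℕ) :
    (partialQuotient α (k + 1) : ℝ) = (gaussOrbit α k)⁻¹ - gaussOrbit α (k + 1) := by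
  obtain ⟨b, hb⟩ := exists_stream_eq hα hα0 hα1 k
  have h1 := GenContFract.IntFractPair.stream_succ_of_some hb
    (irrational_gaussOrbit hα k).ne_zero
  have h2 : (0 : ℤ) ≤ ⌊(gaussOrbit α k)⁻¹⌋ :=
    Int.floor_nonneg.2 (inv_nonneg.2 (gaussOrbit_mem hα hα0 hα1 k).1.le)
  have h3 : partialQuotient α (k + 1) = ⌊(gaussOrbit α k)⁻¹⌋.toNat := by
    simp [partialQuotient, h1, GenContFract.IntFractPair.of]
  have h4 : ((⌊(gaussOrbit α k)⁻¹⌋.toNat : ℤ) : ℝ) = ⌊(gaussOrbit α k)⁻¹⌋ := by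
    rw [Int.toNat_of_nonneg h2]
  rw [h3, gaussOrbit, ← Int.self_sub_floor, ← h4]
  push_cast
  ring

include hα hα0 hα1 in
theorem gaussProd_pos (k : ℕ) : 0 < gaussProd α k :=
  Finset.prod_pos fun i _ => (gaussOrbit_mem hα hα0 hα1 i).1

theorem gaussProd_zero : gaussProd α 0 = α := by simp [gaussProd, gaussOrbit]

theorem gaussProd_succ (k : ℕ) : gaussProd α (k + 1) = gaussProd α k * gaussOrbit α (k + 1) :=
  Finset.prod_range_succ _ _

include hα hα0 hα1 in
theorem gaussProd_succ_lt (k : ℕ) : gaussProd α (k + 1) < gaussProd α k := by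
  rw [gaussProd_succ]
  exact mul_lt_of_lt_one_right (gaussProd_pos hα hα0 hα1 k) (gaussOrbit_mem hα hα0 hα1 _).2

include hα hα0 hα1 in
theorem gaussProd_one : gaussProd α 1 = 1 - partialQuotient α 1 * gaussProd α 0 := by
  rw [← zero_add 1, partialQuotient_succ hα hα0 hα1, gaussProd_succ, gaussProd_zero, gaussOrbit]
  field_simp
  ring

include hα hα0 hα1 in
theorem gaussProd_add_two (k : ℕ) : gaussProd α (k + 2) =
    gaussProd α k - partialQuotient α (k + 2) * gaussProd α (k + 1) := by
  have := (gaussOrbit_mem hα hα0 hα1 (k + 1)).1.ne'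
  rw [partialQuotient_succ hα hα0 hα1, gaussProd_succ, gaussProd_succ]
  field_simp
  ring

end ContinuedFraction

end Sturmian

/-! ### Sturmian words as codings of hyperreal points -/

namespace Sturmian

open Hyperreal RotationData

theorem two_le_partialQuotient_one {α : ℝ} (hα : Irrational α) (hα0 : 0 < α)
    (hα1 : α < 1 / 2) : 2 ≤ partialQuotient α 1 := by
  have hlt : α < 1 := by linarith
  have h1 := gaussProd_one hα hα0 hlt
  have h2 := gaussProd_succ_lt hα hα0 hlt 0
  rw [zero_add, h1, gaussProd_zero] at h2
  by_contra! h
  have h3 : (partialQuotient α 1 : ℝ) ≤ 1 := by exact_mod_cast Nat.le_of_lt_succ h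
  nlinarith

/-- The embedding of the real numbers into the hyperreal numbers. -/
noncomputable def ofRealHom : ℝ →+* ℝ* where
  toFun x := x
  map_one' := rfl
  map_zero' := rfl
  map_mul' _ _ := rfl
  map_add' _ _ := rfl

theorem ofRealHom_lt {x y : ℝ} : ofRealHom x < ofRealHom y ↔ x < y := Hyperreal.coe_lt_coe

/-- The rotation by the real number `α`, viewed in the hyperreal numbers. -/
noncomputable def rotation {α : ℝ} (hα : Irrational α) (hα0 : 0 < α)
    (hα1 : α < 1 / 2) : RotationData ℝ* where
  F := ofRealHom.fieldRange
  a := partialQuotient α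
  t k := ofRealHom (gaussProd α k)
  t_mem k := ⟨_, rfl⟩
  t_pos k := by
    rw [← map_zero ofRealHom, ofRealHom_lt]
    exact gaussProd_pos hα hα0 (by linarith) k
  t_lt k := ofRealHom_lt.2 (gaussProd_succ_lt hα hα0 (by linarith) k)
  two_le_a_one := two_le_partialQuotient_one hα hα0 hα1
  t_one := by
    rw [gaussProd_one hα hα0 (by linarith), map_sub, map_mul, map_one, map_natCast]
  t_rec k := by
    rw [gaussProd_add_two hα hα0 (by linarith), map_sub, map_mul, map_natCast]

section Coding

variable {α : ℝ} (hα : Irrational α) (hα0 : 0 < α) (hα1 : α < 1 / 2)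

theorem rotation_t_zero : (rotation hα hα0 hα1).t 0 = ofRealHom α := by
  simp [rotation, gaussProd_zero]

theorem generic_add_epsilon (r : ℝ) {δ : ℝ*} (hδ : δ = ε ∨ δ = -ε) :
    (rotation hα hα0 hα1).Generic (ofRealHom r + δ) := by
  rintro ⟨x, hx⟩
  have h1 : ε = ofRealHom |x - r| := by
    rcases hδ with rfl | rfl
    · have h2 : ε = ofRealHom (x - r) := by rw [map_sub, hx]; ring
      rw [abs_of_pos, h2]
      rw [← ofRealHom_lt, map_zero, ← h2]
      exact epsilon_pos
    · have h2 : ε = ofRealHom (-(x - r)) := by rw [map_neg, map_sub, hx]; ring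
      rw [abs_of_neg, h2]
      rw [← neg_pos, ← ofRealHom_lt, map_zero, ← h2]
      exact epsilon_pos
  have h2 : 0 < |x - r| := by
    rw [← ofRealHom_lt, map_zero, ← h1]
    exact epsilon_pos
  exact (epsilon_lt_of_pos h2).ne h1

theorem lt_add_epsilon {x y : ℝ} (h : x ≤ y) : ofRealHom x < ofRealHom y + ε := by
  have h1 : ofRealHom x ≤ ofRealHom y := Hyperreal.coe_le_coe.2 h
  exact lt_of_le_of_lt h1 (lt_add_of_pos_right _ epsilon_pos)

theorem add_epsilon_lt {x y : ℝ} (h : x < y) : ofRealHom x + ε < ofRealHom y := by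
  have h1 : ε < ofRealHom (y - x) := epsilon_lt_of_pos (sub_pos.2 h)
  rw [map_sub] at h1
  linarith

theorem letter_ofRealHom_fract (r : ℝ) (δ : ℝ*) :
    (rotation hα hα0 hα1).letter (ofRealHom (r - (1 - α)) + δ) =
      (rotation hα hα0 hα1).letter (ofRealHom (Int.fract r - (1 - α)) + δ) := by
  rw [← letter_sub_intCast _ _ ⌊r⌋]
  congr 1
  rw [Int.fract]
  simp only [map_sub, map_intCast]
  ring

theorem letter_add_epsilon (r : ℝ) :
    (rotation hα hα0 hα1).letter (ofRealHom (r - (1 - α)) + ε) = 1 ↔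
      1 - α ≤ Int.fract r := by
  rw [letter_ofRealHom_fract]
  have h0 := Int.fract_nonneg r
  have h1 := Int.fract_lt_one r
  rcases le_or_gt (1 - α) (Int.fract r) with h | h
  · rw [letter_eq_one]
    · simp [h]
    · rw [← map_zero ofRealHom]
      exact lt_add_epsilon (by linarith)
    · rw [rotation_t_zero]
      exact add_epsilon_lt (by linarith)
  · rw [letter_eq_zero]
    · exact iff_of_false (by decide) (not_le.2 h)
    · rw [rotation_t_zero, ← map_one ofRealHom, ← map_sub]
      exact lt_add_epsilon (by linarith)
    · rw [← map_zero ofRealHom]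
      exact add_epsilon_lt (by linarith)

theorem letter_sub_epsilon (r : ℝ) :
    (rotation hα hα0 hα1).letter (ofRealHom (r - (1 - α)) + -ε) = 1 ↔
      (1 - α < Int.fract r ∨ Int.fract r = 0) := by
  rw [letter_ofRealHom_fract]
  have h0 := Int.fract_nonneg r
  have h1 := Int.fract_lt_one r
  rcases h0.eq_or_lt with h | h
  · rw [← h, ← letter_sub_intCast _ _ (-1), letter_eq_one]
    · simp
    · have := add_epsilon_lt hα0
      simp only [map_sub, map_zero, map_one] at this ⊢
      push_cast
      linarith
    · rw [rotation_t_zero]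
      have := epsilon_pos
      simp only [map_sub, map_zero, map_one]
      push_cast
      linarith
  · rcases lt_or_ge (1 - α) (Int.fract r) with h2 | h2
    · rw [letter_eq_one]
      · simp [h2]
      · have := add_epsilon_lt h2
        rw [map_sub]
        linarith
      · rw [rotation_t_zero]
        have := lt_add_epsilon (show Int.fract r - (1 - α) ≤ α by linarith)
        linarith
    · rw [letter_eq_zero]
      · simp [h2, h.ne']
      · rw [rotation_t_zero]
        have := add_epsilon_lt h
        simp only [map_sub, map_zero, map_one] at this ⊢
        linarith
      · have := lt_add_epsilon h2
        rw [map_sub]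
        linarith

theorem exists_inWindow (x : ℝ) {δ : ℝ*} (hδ : δ = ε ∨ δ = -ε) :
    ∃ m : ℤ, (rotation hα hα0 hα1).InWindow (ofRealHom (x - (1 - α)) + δ - m) := by
  have h0 := Int.fract_nonneg x
  have h1 := Int.fract_lt_one x
  have hx : ∀ m : ℤ, ofRealHom (x - (1 - α)) + δ - (⌊x⌋ + m : ℤ) =
      ofRealHom (Int.fract x - (1 - α)) + δ - m := by
    intro m
    rw [Int.fract]
    simp only [map_sub, map_intCast]
    push_cast
    ring
  have hε := epsilon_pos
  have h2 := add_epsilon_lt h1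
  have h3 := lt_add_epsilon h0
  have h4 := lt_add_epsilon h1.le
  simp only [map_zero, map_one] at h2 h3 h4
  -- Only here does the infinitesimal shift leave the window, just below its left end; one more full
  -- turn brings the point back to just below `α`.
  by_cases h : δ = -ε ∧ Int.fract x = 0
  · refine ⟨⌊x⌋ + (-1 : ℤ), ?_⟩
    rw [hx, h.2, h.1, InWindow, rotation_t_zero]
    have h5 := add_epsilon_lt (show (0 : ℝ) < 1 by norm_num)
    simp only [map_sub, map_zero, map_one] at h5 ⊢
    push_cast
    constructor <;> linarith
  · refine ⟨⌊x⌋ + (0 : ℤ), ?_⟩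
    rw [hx, InWindow, rotation_t_zero]
    simp only [map_sub, map_one, Int.cast_zero]
    rcases hδ with rfl | rfl
    · constructor <;> linarith
    · have h5 := add_epsilon_lt (h0.lt_of_ne fun e => h ⟨rfl, e.symm⟩)
      rw [map_zero] at h5
      constructor <;> linarith

/-- A Sturmian word is the coding of a generic hyperreal point. -/
theorem IsSturmian.exists_generic {s : InfWord} (hs : IsSturmian α s) :
    ∃ y : ℝ*, (rotation hα hα0 hα1).Generic y ∧
      (∃ m : ℤ, (rotation hα hα0 hα1).InWindow (y - m)) ∧
      ∀ n : ℕ, s n = (rotation hα hα0 hα1).letter (y + n * (rotation hα hα0 hα1).t 0) := by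
  have fin_eq : ∀ {c d : Fin 2}, (c = 1 ↔ d = 1) → c = d := by decide
  have hshift : ∀ (x : ℝ) (δ : ℝ*) (n : ℕ),
      ofRealHom (x - (1 - α)) + δ + n * (rotation hα hα0 hα1).t 0 =
      ofRealHom (x + n * α - (1 - α)) + δ := by
    intro x δ n
    rw [rotation_t_zero]
    simp only [map_sub, map_add, map_mul, map_natCast]
    ring
  obtain ⟨x, hx | hx⟩ := hs
  · refine ⟨_, generic_add_epsilon hα hα0 hα1 (x - (1 - α)) (Or.inl rfl),
      exists_inWindow hα hα0 hα1 x (Or.inl rfl), fun n => fin_eq ?_⟩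
    rw [hshift, letter_add_epsilon]
    exact hx n
  · refine ⟨_, generic_add_epsilon hα hα0 hα1 (x - (1 - α)) (Or.inr rfl),
      exists_inWindow hα hα0 hα1 x (Or.inr rfl), fun n => fin_eq ?_⟩
    rw [hshift, letter_sub_epsilon]
    exact hx n

theorem occursAt_iff_codes {s : InfWord} {y : ℝ*}
    (hs : ∀ n : ℕ, s n = (rotation hα hα0 hα1).letter (y + n * (rotation hα hα0 hα1).t 0))
    (w : BinWord) (n : ℕ) :
    w.OccursAt s n ↔ (rotation hα hα0 hα1).Codes w (y + n * (rotation hα hα0 hα1).t 0) := by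
  refine forall₂_congr fun i hi => ?_
  rw [hs]
  push_cast
  rw [add_mul, ← add_assoc]

theorem IsMaximalSolutionAt.maxSolutionAt {s : InfWord} {y : ℝ*} (hSt : IsSturmian α s)
    (hs : ∀ n : ℕ, s n = (rotation hα hα0 hα1).letter (y + n * (rotation hα hα0 hα1).t 0))
    {w : BinWord} {n : ℕ}
    (h : IsMaximalSolutionAt α s n w) :
    (rotation hα hα0 hα1).MaxSolutionAt w (y + n * (rotation hα hα0 hα1).t 0) := by
  obtain ⟨⟨⟨h1, h2, -⟩, h3⟩, h4⟩ := h
  refine ⟨⟨h1, h2, (occursAt_iff_codes hα hα0 hα1 hs _ _).1 h3⟩, fun v hv => ?_⟩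
  obtain ⟨h5, h6, h7⟩ := hv
  have h8 := (occursAt_iff_codes hα hα0 hα1 hs _ _).2 h7
  exact h4 v ⟨h5, h6, s, hSt, n, h8⟩ h8

end Coding

end Sturmian

open Sturmian RotationData in
theorem proposition6p10 (α : ℝ) (hα : Irrational α) (hα0 : 0 < α) (hα1 : α < 1 / 2)
    (s : InfWord) (X : ℕ → BinWord) (hX : Sturmian.IsTypeAFactorization α s X) :
    ((X 1).length < (X 0).length →
      (∃ k ℓ : ℕ, 2 ≤ k ∧ 0 < ℓ ∧ ℓ ≤ Sturmian.partialQuotient α k - 1 ∧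
        X 0 = (Sturmian.semistandardWord α k ℓ).reverse ∧
        BinWord.IsRootOf (Sturmian.standardWord α (k - 1)).reverse (X 1)) ∧
      (X 0).length < (X 2).length) ∧
    Filter.liminf (fun i : ℕ => ((X i).length : ℕ∞)) Filter.atTop = ⊤ := by
  obtain ⟨y, hy, ⟨m, hm⟩, hs⟩ := hX.1.exists_generic hα hα0 hα1
  -- Membership of squares in the language is automatic for words occurring in `s`, so maximality
  -- transfers to the coding of `y`.
  have hmax := fun i => (hX.2 i).maxSolutionAt hα hα0 hα1 hX.1 hs
  have horb : (rotation hα hα0 hα1).OrbitAt X y 0 (y - m) := ⟨m, by simp⟩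
  refine ⟨fun hlen => ?_, ?_⟩
  · obtain ⟨k, l, n, hl, hl', h0, h1, h2⟩ := horb.of_length_lt hmax hy hm hlen
    refine ⟨⟨k + 2, l, by omega, hl, Nat.le_sub_one_of_lt hl', ?_, ?_, n + 1, by omega, ?_⟩, h2⟩
    · rw [reverse_semistandardWord]
      exact h0
    · rw [reverse_standardWord]
      exact isPrimitive_revStandard _ _
    · rw [reverse_standardWord]
      exact h1
  · refine Filter.Tendsto.liminf_eq (ENat.tendsto_nhds_top_iff_natCast_lt.2 fun k => ?_)
    obtain ⟨N, hN⟩ := horb.eventually_le_length hmax hy hm k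
    filter_upwards [Filter.eventually_ge_atTop N] with i hi
    exact_mod_cast hN i hi
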